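/- Let $p\ge 9$ be real. For $r\in\mathbb R$ let $e^{ir\partial_x^2}$ be the linear Schrödinger propagator on $L^2(\mathbb R)$, i.e. the Fourier multiplier $e^{-ir\xi^2}$ (where $\partial_x\leftrightarrow i\xi$). Let $H^{3,3}(\mathbb R)$ be the space of $f\in L^2(\mathbb R)$ with $\partial_x^3f\in L^2(\mathbb R)$ and $x^3f\in L^2(\mathbb R)$, with norm $\|f\|_{H^{3,3}}=\big(\|f\|_{L^2}^2+\|\partial_x^3f\|_{L^2}^2+\|x^3f\|_{L^2}^2\big)^{1/2}$. For $f\in H^1(\mathbb R)$ put $$E[f]=\frac12\|\partial_xf\|_{L^2}^2-\frac1{p+1}\int_0^1\|e^{ir\partial_x^2}f\|_{L^{p+1}}^{p+1}\,dr .$$ Let $T_{\min},T_{\max}\in(0,\infty]$, $u_0\in H^{3,3}(\mathbb R)$, and let $u\in C((-T_{\min},T_{\max});H^{3,3}(\mathbb R))$ be a solution (for example, the maximal $H^{3,3}$ solution) of $$i\partial_tu+\partial_x^2u+\int_0^1e^{-ir\partial_x^2}\big(|e^{ir\partial_x^2}u|^{p-1}e^{ir\partial_x^2}u\big)\,dr=0,\qquad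 u(0)=u_0,$$ the equation being understood in $L^2(\mathbb R)$ at every $t\in(-T_{\min},T_{\max})$. For $t\in(-T_{\min},T_{\max})$ define $$\mathcal V(t)=\int_{\mathbb R}x^2|u(t,x)|^2\,dx,\qquad \mathcal V_1'(t)=4\,\mathrm{Im}\int_{\mathbb R}x\,\partial_xu(t,x)\,\overline{u(t,x)}\,dx,$$ $$\Phi(t)=16E[u_0]-\frac{4(p-9)}{p+1}\int_0^1\int_{\mathbb R}|e^{ir\partial_x^2}u(t,x)|^{p+1}\,dx\,dr .$$ Then all these integrals converge absolutely, $\Phi$ is integrable on the interval between $0$ and $t$ for every $t\in(-T_{\min},T_{\max})$, and for all $t$ with $-T_{\min}<t\le 0$ $$\mathcal V(t)\le\mathcal V(0)+\mathcal V_1'(0)\,t+\int_0^t\int_0^s\Phi(\tau)\,d\tau\,ds .$$ -/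

import Mathlib

open MeasureTheory Filter Topology
open scoped SchwartzMap FourierTransform LineDeriv ComplexConjugate

noncomputable section

namespace DMNLS

/-- The complex Hilbert space `L²(ℝ)`. -/
abbrev L2 : Type := Lp ℂ 2 (volume : Measure ℝ)

/-- `g ∈ L²(ℝ)` is the `k`-th distributional derivative of `f ∈ L²(ℝ)`
(both are coerced to tempered distributions on `ℝ`). -/
def IsWeakDeriv (k : ℕ) (f g : L2) : Prop :=
  ∂^{fun _ : Fin k => (1 : ℝ)} (f : 𝓢'(ℝ, ℂ)) = (g : 𝓢'(ℝ, ℂ))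

open Classical in
/-- `∂ₓᵏ f`, for `f ∈ L²(ℝ)` whose `k`-th distributional derivative lies in `L²(ℝ)`
(and `0` otherwise). -/
def weakDeriv (k : ℕ) (f : L2) : L2 :=
  if h : ∃ g : L2, IsWeakDeriv k f g then h.choose else 0

theorem IsWeakDeriv.weakDeriv_eq {k : ℕ} {f g : L2} (h : IsWeakDeriv k f g) :
    weakDeriv k f = g := by
  have h' : ∃ g : L2, IsWeakDeriv k f g := ⟨g, h⟩
  have h1 : IsWeakDeriv k f (weakDeriv k f) := by
    rw [weakDeriv, dif_pos h']
    exact h'.choose_spec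
  have h2 : Lp.toTemperedDistributionCLM ℂ (volume : Measure ℝ) 2 (weakDeriv k f) =
      Lp.toTemperedDistributionCLM ℂ (volume : Measure ℝ) 2 g := by
    rw [Lp.toTemperedDistributionCLM_apply, Lp.toTemperedDistributionCLM_apply]
    exact h1.symm.trans h
  exact LinearMap.ker_eq_bot.mp Lp.ker_toTemperedDistributionCLM_eq_bot h2

open Classical in
/-- `xᵏ f`, for `f ∈ L²(ℝ)` with `xᵏ f ∈ L²(ℝ)` (and `0` otherwise). -/
def weightMul (k : ℕ) (f : L2) : L2 :=
  if h : MemLp (fun x : ℝ => ((x ^ k : ℝ) : ℂ) * f x) 2 volume then h.toLp else 0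

/-- Membership in the weighted Sobolev space `H^{k,k}(ℝ)`:
`f`, `∂ₓᵏ f` and `xᵏ f` all belong to `L²(ℝ)`. -/
def MemHkk (k : ℕ) (f : L2) : Prop :=
  (∃ g : L2, IsWeakDeriv k f g) ∧ MemLp (fun x : ℝ => ((x ^ k : ℝ) : ℂ) * f x) 2 volume

/-- The norm `(‖f‖² + ‖∂ₓᵏ f‖² + ‖xᵏ f‖²)^{1/2}` of `H^{k,k}(ℝ)`. -/
def hkkNorm (k : ℕ) (f : L2) : ℝ :=
  Real.sqrt (‖f‖ ^ 2 + ‖weakDeriv k f‖ ^ 2 + ‖weightMul k f‖ ^ 2)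

/-- The Fourier symbol of `e^{ir∂ₓ²}`. With the normalization
`𝓕 f ξ = ∫ e^{-2πixξ} f x dx`, the operator `∂ₓ²` has the symbol `-(2πξ)²`. -/
def propagatorSymbol (r ξ : ℝ) : ℂ :=
  Complex.exp (-(Complex.I * ((r * (2 * Real.pi * ξ) ^ 2 : ℝ) : ℂ)))

theorem norm_propagatorSymbol (r ξ : ℝ) : ‖propagatorSymbol r ξ‖ = 1 := by
  simp only [propagatorSymbol, Complex.norm_exp]
  rw [Complex.neg_re, Complex.I_mul_re, Complex.ofReal_im]
  simp

theorem continuous_propagatorSymbol (r : ℝ) : Continuous (propagatorSymbol r) := by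
  unfold propagatorSymbol
  fun_prop

theorem memLp_propagatorSymbol_mul (r : ℝ) (f : L2) :
    MemLp (fun ξ : ℝ => propagatorSymbol r ξ * f ξ) 2 volume :=
  (Lp.memLp f).of_le
    ((continuous_propagatorSymbol r).aestronglyMeasurable.mul (Lp.memLp f).1)
    (Eventually.of_forall fun ξ => by rw [norm_mul, norm_propagatorSymbol, one_mul])

/-- The linear propagator `e^{ir∂ₓ²}` on `L²(ℝ)`, through the Fourier transform on `L²(ℝ)`. -/
def propagator (r : ℝ) (f : L2) : L2 :=
  𝓕⁻ ((memLp_propagatorSymbol_mul r (𝓕 f)).toLp)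

open Classical in
/-- The power `|v|^{p-1} v`, for `v ∈ L²(ℝ)` such that it lies in `L²(ℝ)` (and `0` otherwise). -/
def powerNL (p : ℝ) (v : L2) : L2 :=
  if h : MemLp (fun x : ℝ => ((‖v x‖ ^ (p - 1) : ℝ) : ℂ) * v x) 2 volume then h.toLp else 0

/-- The averaged nonlinearity `∫₀¹ e^{-ir∂ₓ²}(|e^{ir∂ₓ²}f|^{p-1} e^{ir∂ₓ²}f) dr`,
an `L²(ℝ)`-valued Bochner integral. -/
def avgNL (p : ℝ) (f : L2) : L2 :=
  ∫ r in (0 : ℝ)..1, propagator (-r) (powerNL p (propagator r f))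

/-- The open interval `(-Tmin, Tmax)` of real times. -/
def timeInterval (Tmin Tmax : EReal) : Set ℝ :=
  {t : ℝ | -Tmin < (t : EReal) ∧ (t : EReal) < Tmax}

/-- `u ∈ C((-Tmin, Tmax); H^{3,3}(ℝ))` solves
`i∂ₜu + ∂ₓ²u + ∫₀¹ e^{-ir∂ₓ²}(|e^{ir∂ₓ²}u|^{p-1} e^{ir∂ₓ²}u) dr = 0`, `u(0) = u₀`.
The equation holds in `L²(ℝ)` at each time, with `∂ₜu` the derivative of the `L²(ℝ)`-valued
map `u`. -/
structure IsSolution (p : ℝ) (Tmin Tmax : EReal) (u₀ : L2) (u : ℝ → L2) : Prop where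
  mem : ∀ t ∈ timeInterval Tmin Tmax, MemHkk 3 (u t)
  continuous : ∀ t ∈ timeInterval Tmin Tmax,
    Tendsto (fun s => hkkNorm 3 (u s - u t)) (𝓝[timeInterval Tmin Tmax] t) (𝓝 0)
  initial : u 0 = u₀
  equation : ∀ t ∈ timeInterval Tmin Tmax, ∃ ut : L2, HasDerivAt u ut t ∧
    Complex.I • ut + weakDeriv 2 (u t) + avgNL p (u t) = 0

/-- `∫_ℝ |e^{ir∂ₓ²} f|^{p+1} dx`. -/
def potential (p r : ℝ) (f : L2) : ℝ :=
  ∫ x : ℝ, ‖propagator r f x‖ ^ (p + 1)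

/-- The energy `E[f] = ½ ‖∂ₓf‖² - (p+1)⁻¹ ∫₀¹ ‖e^{ir∂ₓ²}f‖_{L^{p+1}}^{p+1} dr`. -/
def energy (p : ℝ) (f : L2) : ℝ :=
  1 / 2 * ‖weakDeriv 1 f‖ ^ 2 - 1 / (p + 1) * ∫ r in (0 : ℝ)..1, potential p r f

/-- The variance `∫ x² |f|² dx`. -/
def variance (f : L2) : ℝ :=
  ∫ x : ℝ, x ^ 2 * ‖f x‖ ^ 2

/-- `4 Im ∫ x (∂ₓf) f̄ dx`. -/
def virial (f : L2) : ℝ :=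
  4 * (∫ x : ℝ, (x : ℂ) * weakDeriv 1 f x * conj (f x)).im

/-- `16 E[u₀] - (4(p-9)/(p+1)) ∫₀¹ ∫ |e^{ir∂ₓ²} f|^{p+1} dx dr`; at time `τ` it is used with
`f = u τ`. -/
def Phi (p : ℝ) (u₀ f : L2) : ℝ :=
  16 * energy p u₀ - 4 * (p - 9) / (p + 1) * ∫ r in (0 : ℝ)..1, potential p r f

end DMNLS

end

/-! Write U(r) for the propagator, N = `avgNL p u`, P(r) = `potential p r u`, A = ∫₀¹ P, V for the
variance, W for the virial and ⟨f, g⟩ = ∫ f̄ g. The equation says u_t = i(u_xx + N), hence V' = W +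
2 Im⟨N, x²u⟩. For a pointwise nonlinearity the last term would vanish; after averaging over r it
survives, and the theorem rests on its sign.

The term is computed for each r. With v = U(r)u, the commutation x v = U(r)(x u) − 2ir v_x
(`IsMul.propagator`) expresses U(r)(x²u) and U(r)(x u_x) through x²v, x v_x, v and v_xx. Three facts
then suffice: Im⟨|v|^{p-1}v, x²v⟩ = 0; the dilation identity (p+1) Re⟨|v|^{p-1}v, x v_x⟩ = −P(r)
(`re_inner_powerNL_dilation`); and P'(r) = (p+1) Re⟨|v|^{p-1}v, i v_xx⟩ (`hasDerivAt_potential`).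
Integration by parts in r gives (p+1) Im⟨N, x²u⟩ = 4P(1) + 2(p−5) ∫₀¹ r P(r) dr ≥ 0 and (p+1) Re⟨N,
x u_x⟩ = 2P(1) − 3A. The first yields V' ≥ W. The second, with conservation of energy, yields W' = Φ
− 16 P(1)/(p+1) ≤ Φ. Integrating backwards from 0 turns W' ≤ Φ into a lower bound for W on the past;
since V' ≥ W, this becomes an upper bound for V (`le_of_second_order_inequality`).

The curve u is differentiable in time only in L², while V, W and E involve unbounded operators. They
are differentiated without further regularity of u_t: for Re⟨Bu, u⟩ with B symmetric, continuity of
Bu is enough (`hasDerivAt_quadratic`), and for the potential part convexity controls the remainder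
(`hasDerivAt_of_convex`). Continuity in H^{3,3} supplies the continuity of u_xx, x²u and x u_x. -/

noncomputable section

namespace DMNLS

/-! ### Multiplication relations and their Fourier counterparts -/

/-- `g` is the product of `f` with the function `a`. -/
def IsMul (a : ℝ → ℂ) (f g : L2) : Prop := ∀ᵐ x, g x = a x * f x

theorem exists_isMul {a : ℝ → ℂ} {f : L2} (h : MemLp (fun x => a x * f x) 2 volume) :
    ∃ g, IsMul a f g := ⟨h.toLp, h.coeFn_toLp⟩

theorem IsMul.unique {a : ℝ → ℂ} {f g h : L2} (hg : IsMul a f g) (hh : IsMul a f h) : g = h := by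
  apply Lp.ext
  filter_upwards [hg, hh] with x h1 h2
  rw [h1, h2]

theorem IsMul.memLp {a : ℝ → ℂ} {f g : L2} (h : IsMul a f g) :
    MemLp (fun x => a x * f x) 2 volume :=
  (Lp.memLp g).ae_eq h

theorem IsMul.add {a : ℝ → ℂ} {f g f' g' : L2} (h : IsMul a f g) (h' : IsMul a f' g') :
    IsMul a (f + f') (g + g') := by
  filter_upwards [h, h', Lp.coeFn_add f f', Lp.coeFn_add g g'] with x h1 h2 h3 h4
  rw [h3, h4, Pi.add_apply, Pi.add_apply, h1, h2, mul_add]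

theorem IsMul.sub {a : ℝ → ℂ} {f g f' g' : L2} (h : IsMul a f g) (h' : IsMul a f' g') :
    IsMul a (f - f') (g - g') := by
  filter_upwards [h, h', Lp.coeFn_sub f f', Lp.coeFn_sub g g'] with x h1 h2 h3 h4
  rw [h3, h4, Pi.sub_apply, Pi.sub_apply, h1, h2, mul_sub]

theorem IsMul.smul {a : ℝ → ℂ} {f g : L2} (c : ℂ) (h : IsMul a f g) :
    IsMul a (c • f) (c • g) := by
  filter_upwards [h, Lp.coeFn_smul c f, Lp.coeFn_smul c g] with x h1 h2 h3
  rw [h2, h3, Pi.smul_apply, Pi.smul_apply, h1, smul_eq_mul, smul_eq_mul]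
  ring

theorem IsMul.const_mul {a : ℝ → ℂ} {f g : L2} (c : ℂ) (h : IsMul a f g) :
    IsMul (fun x => c * a x) f (c • g) := by
  filter_upwards [h, Lp.coeFn_smul c g] with x h1 h3
  rw [h3, Pi.smul_apply, h1, smul_eq_mul, mul_assoc]

theorem IsMul.mul {a b : ℝ → ℂ} {f g h : L2} (hg : IsMul a f g) (hh : IsMul b g h) :
    IsMul (fun x => b x * a x) f h := by
  filter_upwards [hg, hh] with x h1 h2
  rw [h2, h1, mul_assoc]

theorem IsMul.of_mul {a b : ℝ → ℂ} {f g h : L2} (hg : IsMul a f g)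
    (hh : IsMul (fun x => b x * a x) f h) : IsMul b g h := by
  filter_upwards [hg, hh] with x h1 h2
  rw [h2, h1, mul_assoc]

/-- Gives intermediate powers from the extreme ones. It is applied both to weights x^j and, on the
Fourier side, to symbols (2πiξ)^j. -/
theorem exists_isMul_of_le {a b : ℝ → ℂ} (ha : Continuous a) {f g : L2} (hg : IsMul b f g)
    (hab : ∀ x, ‖a x‖ ≤ 1 + ‖b x‖) : ∃ h, IsMul a f h ∧ ‖h‖ ≤ ‖f‖ + ‖g‖ := by
  have hdom : ∀ᵐ x, ‖a x * f x‖ ≤ ‖‖f x‖ + ‖g x‖‖ := by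
    filter_upwards [hg] with x hx
    rw [Real.norm_of_nonneg (by positivity), hx, norm_mul, norm_mul]
    nlinarith [hab x, norm_nonneg (f x)]
  have hsum : MemLp (fun x => ‖f x‖ + ‖g x‖) 2 volume := (Lp.memLp f).norm.add (Lp.memLp g).norm
  have hm : MemLp (fun x => a x * f x) 2 volume :=
    hsum.of_le (ha.aestronglyMeasurable.mul (Lp.memLp f).1) hdom
  refine ⟨hm.toLp, hm.coeFn_toLp, ?_⟩
  have h1 : ‖hm.toLp‖ ≤ ‖hsum.toLp‖ := by
    apply Lp.norm_le_norm_of_ae_le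
    filter_upwards [hm.coeFn_toLp, hsum.coeFn_toLp, hdom] with x h1 h2 h3
    rw [h1, h2]; exact h3
  refine h1.trans ?_
  have h2 : hsum.toLp = (Lp.memLp f).norm.toLp + (Lp.memLp g).norm.toLp := rfl
  rw [h2]
  refine (norm_add_le _ _).trans (le_of_eq ?_)
  rw [Lp.norm_toLp, Lp.norm_toLp, eLpNorm_norm, eLpNorm_norm, Lp.norm_def, Lp.norm_def]

theorem inner_eq_integral (f g : L2) : inner ℂ f g = ∫ x, g x * conj (f x) := by
  rw [L2.inner_def]; rfl

theorem integrable_mul_conj (f g : L2) : Integrable (fun x => g x * conj (f x)) :=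
  L2.integrable_inner (𝕜 := ℂ) f g

theorem norm_sq_eq_integral (f : L2) : ‖f‖ ^ 2 = ∫ x, ‖f x‖ ^ 2 := by
  have h := inner_self_eq_norm_sq_to_K (𝕜 := ℂ) f
  rw [inner_eq_integral] at h
  have h2 : ∀ x, f x * conj (f x) = ((‖f x‖ ^ 2 : ℝ) : ℂ) := fun x => by
    rw [Complex.mul_conj, Complex.normSq_eq_norm_sq]
  simp_rw [h2] at h
  rw [integral_complex_ofReal] at h
  exact Complex.ofReal_injective (by push_cast; exact h.symm)

theorem integrable_norm_sq (f : L2) : Integrable (fun x => ‖f x‖ ^ 2) :=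
  (Lp.memLp f).integrable_norm_pow (by norm_num)

theorem IsMul.inner_left {a : ℝ → ℝ} {f g h k : L2} (hg : IsMul (fun x => a x) f g)
    (hk : IsMul (fun x => a x) h k) : inner ℂ g h = inner ℂ f k := by
  rw [inner_eq_integral, inner_eq_integral]
  apply integral_congr_ae
  filter_upwards [hg, hk] with x h1 h2
  rw [h1, h2, map_mul, Complex.conj_ofReal]
  ring

/-! ### Weak derivatives as multiplication operators on the Fourier side. -/

theorem toTemperedDistribution_smul (c : ℂ) (f : L2) :
    ((c • f : L2) : 𝓢'(ℝ, ℂ)) = c • (f : 𝓢'(ℝ, ℂ)) :=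
  (Lp.toTemperedDistributionCLM ℂ (volume : Measure ℝ) 2).map_smul c f

theorem toTemperedDistribution_add (f g : L2) :
    ((f + g : L2) : 𝓢'(ℝ, ℂ)) = (f : 𝓢'(ℝ, ℂ)) + (g : 𝓢'(ℝ, ℂ)) :=
  (Lp.toTemperedDistributionCLM ℂ (volume : Measure ℝ) 2).map_add f g

/-- Real test functions of compact support are Schwartz functions and determine a locally integrable
function almost everywhere. This lets distributional identities be traded for pointwise ones. -/
theorem smulLeftCLM_eq_iff {a : ℝ → ℂ} (ha : a.HasTemperateGrowth) (f g : L2) :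
    TemperedDistribution.smulLeftCLM ℂ a (f : 𝓢'(ℝ, ℂ)) = (g : 𝓢'(ℝ, ℂ)) ↔ IsMul a f g := by
  constructor
  · intro h
    have hf : LocallyIntegrable (fun x => f x) volume :=
      (Lp.memLp f).locallyIntegrable (by norm_num)
    have hg : LocallyIntegrable (fun x => g x) volume :=
      (Lp.memLp g).locallyIntegrable (by norm_num)
    have haf : LocallyIntegrable (fun x => a x * f x) volume := by
      rw [← locallyIntegrableOn_univ] at hf ⊢
      exact hf.continuousOn_mul ha.1.continuous.continuousOn isOpen_univ.isLocallyClosed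
    refine ae_eq_of_integral_contDiff_smul_eq hg haf fun φ hφ hc => ?_
    have hg₁ : HasCompactSupport (Complex.ofRealCLM ∘ φ) := hc.comp_left rfl
    have hg₂ : ContDiff ℝ (⊤ : ℕ∞) (Complex.ofRealCLM ∘ φ) := by fun_prop
    have h1 := DFunLike.congr_fun h (hg₁.toSchwartzMap hg₂)
    simp only [TemperedDistribution.smulLeftCLM_apply_apply, Lp.toTemperedDistribution_apply,
      SchwartzMap.smulLeftCLM_apply_apply ha] at h1
    simp only [HasCompactSupport.toSchwartzMap_toFun, Function.comp_apply, Complex.ofRealCLM_apply,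
      smul_eq_mul] at h1
    simp only [Complex.real_smul]
    rw [← h1]
    exact integral_congr_ae (ae_of_all _ fun x => by ring)
  · intro h
    ext φ
    simp only [TemperedDistribution.smulLeftCLM_apply_apply, Lp.toTemperedDistribution_apply,
      SchwartzMap.smulLeftCLM_apply_apply ha]
    apply integral_congr_ae
    filter_upwards [h] with x hx
    rw [hx]
    simp only [smul_eq_mul]
    ring

theorem isWeakDeriv_one_iff {f g : L2} :
    IsWeakDeriv 1 f g ↔ ∂_{(1 : ℝ)} (f : 𝓢'(ℝ, ℂ)) = (g : 𝓢'(ℝ, ℂ)) := by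
  rw [IsWeakDeriv, LineDeriv.iteratedLineDerivOp_one]

theorem hasTemperateGrowth_symbol (c : ℂ) (k : ℕ) :
    (fun ξ : ℝ => (c * (ξ : ℂ)) ^ k).HasTemperateGrowth := by
  have h : (fun ξ : ℝ => (ξ : ℂ)).HasTemperateGrowth := by fun_prop
  exact ((Function.HasTemperateGrowth.const c).mul h).pow k

theorem smulLeftCLM_id_eq (T : 𝓢'(ℝ, ℂ)) :
    TemperedDistribution.smulLeftCLM ℂ (fun x : ℝ => ((inner ℝ x (1 : ℝ) : ℝ) : ℂ)) T =
      TemperedDistribution.smulLeftCLM ℂ (fun x : ℝ => (x : ℂ)) T := by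
  simp

theorem fourier_iteratedLineDeriv (k : ℕ) (T : 𝓢'(ℝ, ℂ)) :
    𝓕 (∂^{fun _ : Fin k => (1 : ℝ)} T) =
      TemperedDistribution.smulLeftCLM ℂ (fun ξ : ℝ => (2 * Real.pi * Complex.I * (ξ : ℂ)) ^ k)
        (𝓕 T) := by
  induction k with
  | zero => simp
  | succ k ih =>
    have h : (fun ξ : ℝ => (ξ : ℂ)).HasTemperateGrowth := by fun_prop
    rw [LineDeriv.iteratedLineDerivOp_succ_left, TemperedDistribution.fourier_lineDerivOp_eq,
      smulLeftCLM_id_eq]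
    have : (Fin.tail fun _ : Fin (k + 1) => (1 : ℝ)) = fun _ => 1 := rfl
    rw [this, ih, TemperedDistribution.smulLeftCLM_smulLeftCLM_apply
      (hasTemperateGrowth_symbol _ k) h, ← _root_.smul_apply,
      ← TemperedDistribution.smulLeftCLM_smul ((hasTemperateGrowth_symbol _ k).mul h)]
    congr 2
    ext ξ
    simp only [Pi.smul_apply, Pi.mul_apply, smul_eq_mul]
    ring

theorem isWeakDeriv_iff_fourier {k : ℕ} {f g : L2} : IsWeakDeriv k f g ↔
    IsMul (fun ξ : ℝ => (2 * Real.pi * Complex.I * (ξ : ℂ)) ^ k) (𝓕 f) (𝓕 g) := by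
  rw [← smulLeftCLM_eq_iff (hasTemperateGrowth_symbol _ k), IsWeakDeriv,
    ← Lp.fourier_toTemperedDistribution_eq, ← Lp.fourier_toTemperedDistribution_eq,
    ← fourier_iteratedLineDeriv]
  constructor
  · intro h
    rw [h]
  · intro h
    have := congrArg (𝓕⁻ · : 𝓢'(ℝ, ℂ) → 𝓢'(ℝ, ℂ)) h
    simpa using this

/-- The dual of `isWeakDeriv_iff_fourier`. Together they reduce the commutation of x with the
propagator to a product rule for its symbol. -/
theorem isMul_iff_isWeakDeriv_fourier {f g : L2} : IsMul (fun x : ℝ => (x : ℂ)) f g ↔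
    IsWeakDeriv 1 (𝓕 f) (-(2 * Real.pi * Complex.I) • 𝓕 g) := by
  have h : (fun ξ : ℝ => (ξ : ℂ)).HasTemperateGrowth := by fun_prop
  have hc : -(2 * Real.pi * Complex.I) ≠ 0 := by simp [Real.pi_ne_zero]
  rw [isWeakDeriv_one_iff, ← Lp.fourier_toTemperedDistribution_eq,
    TemperedDistribution.lineDerivOp_fourier_eq, smulLeftCLM_id_eq, toTemperedDistribution_smul,
    ← Lp.fourier_toTemperedDistribution_eq, ← smulLeftCLM_eq_iff h, FourierTransform.fourier_smul]
  constructor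
  · intro h
    rw [h]
  · intro h
    have h2 := smul_right_injective _ hc h
    have := congrArg (𝓕⁻ · : 𝓢'(ℝ, ℂ) → 𝓢'(ℝ, ℂ)) h2
    simpa using this

/-- The product rule for weak derivatives. -/
theorem isWeakDeriv_mul {a a' : ℝ → ℂ} (ha : a.HasTemperateGrowth) (ha' : a'.HasTemperateGrowth)
    (hd : ∀ x, HasDerivAt a (a' x) x) {f f' g m k : L2} (hf : IsWeakDeriv 1 f f')
    (hg : IsMul a f g) (hm : IsMul a' f m) (hk : IsMul a f' k) : IsWeakDeriv 1 g (m + k) := by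
  rw [isWeakDeriv_one_iff] at hf ⊢
  rw [toTemperedDistribution_add, ← (smulLeftCLM_eq_iff ha _ _).2 hg,
    ← (smulLeftCLM_eq_iff ha' _ _).2 hm, ← (smulLeftCLM_eq_iff ha _ _).2 hk, ← hf]
  ext φ
  -- With all operators moved onto the test function, what remains is −aφ' = a'φ − (aφ)'.
  change (f : 𝓢'(ℝ, ℂ)) (SchwartzMap.smulLeftCLM ℂ a (-∂_{(1 : ℝ)} φ)) =
    (f : 𝓢'(ℝ, ℂ)) (SchwartzMap.smulLeftCLM ℂ a' φ) +
    (f : 𝓢'(ℝ, ℂ)) (-∂_{(1 : ℝ)} (SchwartzMap.smulLeftCLM ℂ a φ))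
  rw [← map_add]
  congr 1
  ext x
  rw [SchwartzMap.smulLeftCLM_apply_apply ha, _root_.add_apply, _root_.neg_apply,
    _root_.neg_apply, SchwartzMap.lineDerivOp_apply_eq_fderiv,
    SchwartzMap.lineDerivOp_apply_eq_fderiv,
    SchwartzMap.smulLeftCLM_apply_apply ha', fderiv_apply_one_eq_deriv,
    fderiv_apply_one_eq_deriv]
  have h1 : (⇑(SchwartzMap.smulLeftCLM ℂ a φ) : ℝ → ℂ) = fun x => a x * φ x := by
    ext y; rw [SchwartzMap.smulLeftCLM_apply_apply ha, smul_eq_mul]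
  rw [h1, ((hd x).fun_mul φ.differentiableAt.hasDerivAt).deriv]
  simp only [smul_eq_mul]
  ring

theorem IsWeakDeriv.add {k : ℕ} {f f' g g' : L2} (hf : IsWeakDeriv k f f')
    (hg : IsWeakDeriv k g g') : IsWeakDeriv k (f + g) (f' + g') := by
  rw [isWeakDeriv_iff_fourier] at *
  rw [FourierTransform.fourier_add, FourierTransform.fourier_add]
  exact hf.add hg

theorem IsWeakDeriv.smul {k : ℕ} {f f' : L2} (c : ℂ) (hf : IsWeakDeriv k f f') :
    IsWeakDeriv k (c • f) (c • f') := by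
  rw [isWeakDeriv_iff_fourier] at *
  rw [FourierTransform.fourier_smul, FourierTransform.fourier_smul]
  exact hf.smul c

theorem IsWeakDeriv.sub {k : ℕ} {f f' g g' : L2} (hf : IsWeakDeriv k f f')
    (hg : IsWeakDeriv k g g') : IsWeakDeriv k (f - g) (f' - g') := by
  have := hf.add (hg.smul (-1))
  simpa [sub_eq_add_neg] using this

theorem exists_isWeakDeriv_of_le {j k : ℕ} (hjk : j ≤ k) {f h : L2} (hf : IsWeakDeriv k f h) :
    ∃ g, IsWeakDeriv j f g ∧ ‖g‖ ≤ ‖f‖ + ‖h‖ := by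
  rw [isWeakDeriv_iff_fourier] at hf
  obtain ⟨G, hG, hle⟩ := exists_isMul_of_le
    (a := fun ξ : ℝ => (2 * Real.pi * Complex.I * (ξ : ℂ)) ^ j) (by fun_prop) hf (fun ξ => by
      rw [norm_pow, norm_pow]
      rcases le_total ‖2 * Real.pi * Complex.I * (ξ : ℂ)‖ 1 with h | h
      · have := pow_le_one₀ (n := j) (norm_nonneg _) h
        have := pow_nonneg (norm_nonneg (2 * Real.pi * Complex.I * (ξ : ℂ))) k
        linarith
      · have := pow_le_pow_right₀ h hjk
        linarith)
  refine ⟨𝓕⁻ G, ?_, ?_⟩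
  · rw [isWeakDeriv_iff_fourier, FourierTransform.fourier_fourierInv_eq]
    exact hG
  · rw [← Lp.norm_fourier_eq (𝓕⁻ G), FourierTransform.fourier_fourierInv_eq]
    simpa using hle

theorem IsWeakDeriv.of_add {j k : ℕ} {f g h : L2} (hg : IsWeakDeriv j f g)
    (hh : IsWeakDeriv (k + j) f h) : IsWeakDeriv k g h := by
  rw [isWeakDeriv_iff_fourier] at *
  simp_rw [pow_add] at hh
  exact hg.of_mul hh

theorem IsWeakDeriv.inner_left {f f' g g' : L2} (hf : IsWeakDeriv 1 f f')
    (hg : IsWeakDeriv 1 g g') : inner ℂ f' g = -inner ℂ f g' := by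
  rw [isWeakDeriv_iff_fourier] at *
  rw [← Lp.inner_fourier_eq f' g, ← Lp.inner_fourier_eq f g', inner_eq_integral,
    inner_eq_integral, ← integral_neg]
  apply integral_congr_ae
  filter_upwards [hf, hg] with x h1 h2
  rw [h1, h2]
  simp only [pow_one, map_mul, Complex.conj_I, Complex.conj_ofReal, map_ofNat]
  ring

/-! ### The linear propagator -/

theorem isMul_fourier_propagator (r : ℝ) (f : L2) :
    IsMul (propagatorSymbol r) (𝓕 f) (𝓕 (propagator r f)) := by
  rw [propagator, FourierTransform.fourier_fourierInv_eq]
  exact (memLp_propagatorSymbol_mul r (𝓕 f)).coeFn_toLp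

theorem fourier_injective {f g : L2} (h : 𝓕 f = 𝓕 g) : f = g := by
  have := congrArg (𝓕⁻ · : L2 → L2) h
  simpa using this

theorem eq_propagator {r : ℝ} {f g : L2} (h : IsMul (propagatorSymbol r) (𝓕 f) (𝓕 g)) :
    g = propagator r f :=
  fourier_injective (h.unique (isMul_fourier_propagator r f))

theorem propagator_add (r : ℝ) (f g : L2) :
    propagator r (f + g) = propagator r f + propagator r g := by
  symm
  apply eq_propagator
  rw [FourierTransform.fourier_add, FourierTransform.fourier_add]
  exact (isMul_fourier_propagator r f).add (isMul_fourier_propagator r g)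

theorem propagator_smul (r : ℝ) (c : ℂ) (f : L2) :
    propagator r (c • f) = c • propagator r f := by
  symm
  apply eq_propagator
  rw [FourierTransform.fourier_smul, FourierTransform.fourier_smul]
  exact (isMul_fourier_propagator r f).smul c

theorem propagator_sub (r : ℝ) (f g : L2) :
    propagator r (f - g) = propagator r f - propagator r g := by
  have := propagator_add r f ((-1 : ℂ) • g)
  rw [propagator_smul] at this
  simpa [sub_eq_add_neg] using this

theorem propagatorSymbol_add (r s ξ : ℝ) :
    propagatorSymbol (r + s) ξ = propagatorSymbol r ξ * propagatorSymbol s ξ := by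
  rw [propagatorSymbol, propagatorSymbol, propagatorSymbol, ← Complex.exp_add]
  congr 1
  push_cast
  ring

theorem propagatorSymbol_zero (ξ : ℝ) : propagatorSymbol 0 ξ = 1 := by
  simp [propagatorSymbol]

theorem propagator_propagator (r s : ℝ) (f : L2) :
    propagator r (propagator s f) = propagator (r + s) f := by
  apply eq_propagator
  have h := (isMul_fourier_propagator s f).mul (isMul_fourier_propagator r (propagator s f))
  simp_rw [← propagatorSymbol_add] at h
  exact h

theorem propagator_zero (f : L2) : propagator 0 f = f := by
  symm
  apply eq_propagator
  exact ae_of_all _ fun x => by rw [propagatorSymbol_zero, one_mul]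

theorem inner_propagator (r : ℝ) (f g : L2) :
    inner ℂ (propagator r f) (propagator r g) = inner ℂ f g := by
  rw [← Lp.inner_fourier_eq, ← Lp.inner_fourier_eq f g, inner_eq_integral, inner_eq_integral]
  apply integral_congr_ae
  filter_upwards [isMul_fourier_propagator r f, isMul_fourier_propagator r g] with x h1 h2
  have h3 : propagatorSymbol r x * conj (propagatorSymbol r x) = 1 := by
    rw [Complex.mul_conj, Complex.normSq_eq_norm_sq, norm_propagatorSymbol]
    simp
  rw [h1, h2, map_mul]
  linear_combination (𝓕 g : L2) x * conj ((𝓕 f : L2) x) * h3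

theorem inner_propagator_neg (r : ℝ) (f g : L2) :
    inner ℂ f (propagator (-r) g) = inner ℂ (propagator r f) g := by
  rw [← inner_propagator r f, propagator_propagator, add_neg_cancel, propagator_zero]

theorem norm_propagator (r : ℝ) (f : L2) : ‖propagator r f‖ = ‖f‖ := by
  have h := inner_self_eq_norm_sq_to_K (𝕜 := ℂ) (propagator r f)
  rw [inner_propagator, inner_self_eq_norm_sq_to_K] at h
  have h2 : ‖f‖ ^ 2 = ‖propagator r f‖ ^ 2 := by exact_mod_cast h
  exact ((sq_eq_sq₀ (norm_nonneg _) (norm_nonneg _)).1 h2).symm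

theorem hasTemperateGrowth_cexp :
    (fun x : ℝ => Complex.exp (-Complex.I * x)).HasTemperateGrowth := by
  refine ⟨(contDiff_const.mul Complex.ofRealCLM.contDiff).cexp, fun n => ⟨0, 1, fun x => ?_⟩⟩
  rw [norm_iteratedFDeriv_eq_norm_iteratedDeriv]
  -- Each derivative multiplies by −i, so all derivatives have modulus 1; hence the growth exponent
  -- 0 and constant 1.
  have h : iteratedDeriv n (fun x : ℝ => Complex.exp (-Complex.I * x)) =
      fun x : ℝ => (-Complex.I) ^ n * Complex.exp (-Complex.I * x) := by
    induction n with
    | zero => simp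
    | succ n ih =>
      rw [iteratedDeriv_succ, ih]
      ext y
      have h1 : HasDerivAt (fun x : ℝ => -Complex.I * (x : ℂ)) (-Complex.I) y := by
        simpa using (Complex.ofRealCLM.hasDerivAt (x := y)).const_mul (-Complex.I)
      rw [(h1.cexp.const_mul _).deriv]
      ring
  rw [h]
  simp [Complex.norm_exp]

theorem hasTemperateGrowth_propagatorSymbol (r : ℝ) :
    (propagatorSymbol r).HasTemperateGrowth := by
  have h : (fun ξ : ℝ => r * (2 * Real.pi * ξ) ^ 2).HasTemperateGrowth := by
    have h1 : (fun ξ : ℝ => 2 * Real.pi * ξ).HasTemperateGrowth := by fun_prop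
    exact (Function.HasTemperateGrowth.const r).mul (h1.pow 2)
  have h2 := hasTemperateGrowth_cexp.comp h
  convert h2 using 1
  ext ξ
  simp only [propagatorSymbol, Function.comp_apply, neg_mul]

theorem hasDerivAt_propagatorSymbol (r ξ : ℝ) : HasDerivAt (propagatorSymbol r)
    (-(8 * Real.pi ^ 2 * r : ℝ) * Complex.I * ξ * propagatorSymbol r ξ) ξ := by
  have h0 : HasDerivAt (fun ξ : ℝ => r * (2 * Real.pi * ξ) ^ 2) (8 * Real.pi ^ 2 * r * ξ) ξ := by
    refine ((((hasDerivAt_id' ξ).const_mul (2 * Real.pi)).fun_pow 2).const_mul r).congr_deriv ?_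
    norm_num
    ring
  refine (h0.ofReal_comp.const_mul Complex.I).fun_neg.cexp.congr_deriv ?_
  rw [propagatorSymbol]
  push_cast
  ring

theorem IsWeakDeriv.propagator {k : ℕ} {f g : L2} (h : IsWeakDeriv k f g) (r : ℝ) :
    IsWeakDeriv k (propagator r f) (DMNLS.propagator r g) := by
  rw [isWeakDeriv_iff_fourier] at h ⊢
  filter_upwards [h, isMul_fourier_propagator r f, isMul_fourier_propagator r g] with x h1 h2 h3
  rw [h2, h3, h1]
  ring

/-- The commutation of the position operator with the propagator. -/
theorem IsMul.propagator {f g f' : L2} (h : IsMul (fun x : ℝ => (x : ℂ)) f g)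
    (hf : IsWeakDeriv 1 f f') (r : ℝ) : IsMul (fun x : ℝ => (x : ℂ)) (propagator r f)
      (DMNLS.propagator r g - (2 * r * Complex.I) • DMNLS.propagator r f') := by
  rw [isMul_iff_isWeakDeriv_fourier] at h ⊢
  rw [isWeakDeriv_iff_fourier] at hf
  have ht : (fun ξ : ℝ => -(8 * Real.pi ^ 2 * r : ℝ) * Complex.I * ξ *
      propagatorSymbol r ξ).HasTemperateGrowth := by
    have h1 : (fun ξ : ℝ => -(8 * Real.pi ^ 2 * r : ℝ) * Complex.I * ξ).HasTemperateGrowth := by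
      fun_prop
    exact h1.mul (hasTemperateGrowth_propagatorSymbol r)
  have hpi : (Real.pi : ℂ) ≠ 0 := by exact_mod_cast Real.pi_ne_zero
  -- The symbol's derivative contributes −8π²r iξ = (−4πr)(2πiξ), that is −4πr times the transform
  -- of ∂ₓ. Dividing by the factor −2πi attached to multiplication by x produces the term −2ir ∂ₓ.
  have key := isWeakDeriv_mul (hasTemperateGrowth_propagatorSymbol r) ht
    (hasDerivAt_propagatorSymbol r) (m := (-4 * Real.pi * r : ℂ) • 𝓕 (DMNLS.propagator r f'))
    (k := -(2 * Real.pi * Complex.I) • 𝓕 (DMNLS.propagator r g)) h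
    (isMul_fourier_propagator r f) ?_ ?_
  · convert key using 1
    have : (𝓕 (DMNLS.propagator r g - (2 * r * Complex.I) • DMNLS.propagator r f') : L2) =
        𝓕 (DMNLS.propagator r g) - (2 * r * Complex.I) • 𝓕 (DMNLS.propagator r f') := by
      rw [sub_eq_add_neg, ← neg_smul, FourierTransform.fourier_add, FourierTransform.fourier_smul,
        neg_smul, ← sub_eq_add_neg]
    rw [this, smul_sub, smul_smul, sub_eq_add_neg, add_comm, ← neg_smul]
    congr 2
    linear_combination (4 * Real.pi * r : ℂ) * Complex.I_mul_I
  · filter_upwards [hf, isMul_fourier_propagator r f',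
      Lp.coeFn_smul (-4 * Real.pi * r : ℂ) (𝓕 (DMNLS.propagator r f') : L2)] with x h1 h2 h3
    rw [h3, Pi.smul_apply, h2, h1]
    simp only [smul_eq_mul]
    push_cast
    ring
  · filter_upwards [isMul_fourier_propagator r g,
      Lp.coeFn_smul (-(2 * Real.pi * Complex.I)) (𝓕 (DMNLS.propagator r g) : L2),
      Lp.coeFn_smul (-(2 * Real.pi * Complex.I)) (𝓕 g : L2)] with x h1 h2 h3
    rw [h2, Pi.smul_apply, h1, h3, Pi.smul_apply]
    simp only [smul_eq_mul]
    ring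

/-! ### Strong continuity and generator of the propagator. -/

/-- Dominated convergence for bounded multipliers. It yields both the continuity of the group and,
after division by the symbol of ∂ₓ², its derivative. -/
theorem tendsto_norm_of_isMul {ι : Type*} {l : Filter ι} [l.IsCountablyGenerated]
    {q : ι → ℝ → ℂ} {C : ℝ} {h : L2} {F : ι → L2} (hF : ∀ i, IsMul (q i) h (F i))
    (hq : ∀ i x, ‖q i x‖ ≤ C) (hlim : ∀ x, Tendsto (fun i => q i x) l (𝓝 0)) :
    Tendsto (fun i => ‖F i‖) l (𝓝 0) := by
  have h1 : Tendsto (fun i => ∫ x, ‖q i x * h x‖ ^ 2) l (𝓝 (∫ _ : ℝ, (0 : ℝ))) := by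
    refine tendsto_integral_filter_of_dominated_convergence (fun x => C ^ 2 * ‖h x‖ ^ 2)
      (Eventually.of_forall fun i => ((hF i).memLp.1.norm.pow 2))
      (Eventually.of_forall fun i => ae_of_all _ fun x => ?_)
      ((integrable_norm_sq h).const_mul _) (ae_of_all _ fun x => ?_)
    · rw [norm_mul, mul_pow, Real.norm_of_nonneg (by positivity)]
      gcongr
      exact hq i x
    · have := ((hlim x).mul_const (h x)).norm.pow 2
      simpa using this
  have h3 : ∀ i, ∫ x, ‖q i x * h x‖ ^ 2 = ‖F i‖ ^ 2 := fun i => by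
    rw [norm_sq_eq_integral]
    apply integral_congr_ae
    filter_upwards [hF i] with x hx
    rw [hx]
  simp_rw [h3] at h1
  simp only [integral_zero] at h1
  have h2 := h1.sqrt
  simpa [Real.sqrt_sq] using h2

theorem continuous_propagatorSymbol_left (ξ : ℝ) :
    Continuous fun r => propagatorSymbol r ξ := by
  unfold propagatorSymbol
  fun_prop

/-- Strong continuity of the propagator. -/
theorem continuous_propagator (f : L2) : Continuous fun r => propagator r f := by
  rw [continuous_iff_continuousAt]
  intro r
  rw [ContinuousAt, tendsto_iff_norm_sub_tendsto_zero]
  have hF : ∀ s, IsMul (fun ξ => propagatorSymbol s ξ - propagatorSymbol r ξ) (𝓕 f)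
      (𝓕 (propagator s f) - 𝓕 (propagator r f)) := fun s => by
    filter_upwards [isMul_fourier_propagator s f, isMul_fourier_propagator r f,
      Lp.coeFn_sub (𝓕 (propagator s f)) (𝓕 (propagator r f))] with x h1 h2 h3
    rw [h3, Pi.sub_apply, h1, h2, sub_mul]
  have h := tendsto_norm_of_isMul (l := 𝓝 r) (C := 2) hF (fun s x => by
    refine (norm_sub_le _ _).trans ?_
    rw [norm_propagatorSymbol, norm_propagatorSymbol]
    norm_num) (fun x => by
      have := ((continuous_propagatorSymbol_left x).tendsto r).sub_const (propagatorSymbol r x)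
      simpa using this)
  convert h using 2 with s
  rw [← Lp.norm_fourier_eq]
  congr 1
  rw [sub_eq_add_neg, sub_eq_add_neg, FourierTransform.fourier_add]
  congr 1
  simp

theorem continuous_propagator_comp {X : Type*} [TopologicalSpace X] {r : X → ℝ} {w : X → L2}
    (hr : Continuous r) (hw : Continuous w) : Continuous fun s => propagator (r s) (w s) := by
  rw [continuous_iff_continuousAt]
  intro s
  rw [ContinuousAt, tendsto_iff_norm_sub_tendsto_zero]
  have h1 : Tendsto (fun σ => ‖w σ - w s‖) (𝓝 s) (𝓝 0) :=
    tendsto_iff_norm_sub_tendsto_zero.1 (hw.tendsto s)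
  have h2 : Tendsto (fun σ => ‖propagator (r σ) (w s) - propagator (r s) (w s)‖) (𝓝 s) (𝓝 0) :=
    tendsto_iff_norm_sub_tendsto_zero.1 (((continuous_propagator (w s)).comp hr).tendsto s)
  have h3 := h1.add h2
  rw [add_zero] at h3
  refine squeeze_zero (fun _ => norm_nonneg _) (fun σ => ?_) h3
  rw [← norm_propagator (r σ) (w σ - w s), propagator_sub]
  exact norm_sub_le_norm_sub_add_norm_sub _ _ _

theorem norm_propagatorSymbol_sub_one_le (s ξ : ℝ) :
    ‖propagatorSymbol s ξ - 1‖ ≤ |s| * (2 * Real.pi * ξ) ^ 2 := by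
  have h : propagatorSymbol s ξ =
      Complex.exp (Complex.I * ((-(s * (2 * Real.pi * ξ) ^ 2) : ℝ) : ℂ)) := by
    rw [propagatorSymbol]
    push_cast
    ring_nf
  rw [h]
  refine (Real.norm_exp_I_mul_ofReal_sub_one_le (x := -(s * (2 * Real.pi * ξ) ^ 2))).trans ?_
  rw [Real.norm_eq_abs, abs_neg, abs_mul, abs_of_nonneg (sq_nonneg (2 * Real.pi * ξ))]

theorem hasDerivAt_propagatorSymbol_left (ξ : ℝ) :
    HasDerivAt (fun r => propagatorSymbol r ξ) (-(Complex.I * ((2 * Real.pi * ξ) ^ 2 : ℝ))) 0 := by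
  have h0 : HasDerivAt (fun r : ℝ => r * (2 * Real.pi * ξ) ^ 2) ((2 * Real.pi * ξ) ^ 2) 0 := by
    simpa using (hasDerivAt_id (0 : ℝ)).mul_const ((2 * Real.pi * ξ) ^ 2)
  refine (h0.ofReal_comp.const_mul Complex.I).fun_neg.cexp.congr_deriv ?_
  simp

theorem tendsto_propagator_slope {f f2 : L2} (hf : IsWeakDeriv 2 f f2) :
    Tendsto (fun s : ℝ => ‖((s⁻¹ : ℝ) : ℂ) • (propagator s f - f) - Complex.I • f2‖) (𝓝[≠] 0)
      (𝓝 0) := by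
  rw [isWeakDeriv_iff_fourier] at hf
  -- The multiplier is taken relative to the transform of `f2`, so that it is bounded: the quotient
  -- part is at most 1 because |e^{-isλ} − 1| ≤ |s|λ, and i adds 1, which gives C = 2. The point ξ =
  -- 0 is a null set.
  set q : ℝ → ℝ → ℂ := fun s ξ => if ξ = 0 then 0 else
    (s⁻¹ : ℝ) * (propagatorSymbol s ξ - 1) / ((2 * Real.pi * Complex.I * ξ) ^ 2) - Complex.I with hq
  have hne : ∀ ξ : ℝ, ξ ≠ 0 → (2 * Real.pi * Complex.I * ξ : ℂ) ≠ 0 := fun ξ h => by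
    simp [h, Real.pi_ne_zero]
  have hF : ∀ s, IsMul (q s) (𝓕 f2)
      (𝓕 (((s⁻¹ : ℝ) : ℂ) • (propagator s f - f) - Complex.I • f2)) := fun s => by
    have hlin : (𝓕 (((s⁻¹ : ℝ) : ℂ) • (propagator s f - f) - Complex.I • f2) : L2) =
        ((s⁻¹ : ℝ) : ℂ) • (𝓕 (propagator s f) - 𝓕 f) - Complex.I • 𝓕 f2 := by
      change Lp.fourierTransformₗᵢ ℝ ℂ _ = ((s⁻¹ : ℝ) : ℂ) • (Lp.fourierTransformₗᵢ ℝ ℂ _ -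
        Lp.fourierTransformₗᵢ ℝ ℂ _) - Complex.I • Lp.fourierTransformₗᵢ ℝ ℂ _
      simp only [map_sub, map_smul]
    rw [hlin]
    have h0 : ∀ᵐ ξ : ℝ, ξ ≠ 0 := by simp [ae_iff]
    filter_upwards [hf, isMul_fourier_propagator s f, h0,
      Lp.coeFn_sub (((s⁻¹ : ℝ) : ℂ) • (𝓕 (propagator s f) - 𝓕 f)) (Complex.I • (𝓕 f2 : L2)),
      Lp.coeFn_smul ((s⁻¹ : ℝ) : ℂ) (𝓕 (propagator s f) - 𝓕 f : L2),
      Lp.coeFn_sub (𝓕 (propagator s f)) (𝓕 f : L2),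
      Lp.coeFn_smul Complex.I (𝓕 f2 : L2)] with x h1 h2 h3 h4 h5 h6 h7
    rw [h4, Pi.sub_apply, h5, Pi.smul_apply, h6, Pi.sub_apply, h7, Pi.smul_apply, h2, h1]
    simp only [hq, h3, if_false, smul_eq_mul]
    rw [sub_mul, div_mul_comm, mul_div_cancel_left₀ _ (pow_ne_zero 2 (hne x h3))]
    ring
  have hn : ∀ ξ : ℝ, ‖(2 * Real.pi * Complex.I * ξ : ℂ) ^ 2‖ = (2 * Real.pi * ξ) ^ 2 := fun ξ => by
    have : (2 * Real.pi * Complex.I * ξ : ℂ) ^ 2 = ((-(2 * Real.pi * ξ) ^ 2 : ℝ) : ℂ) := by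
      push_cast
      linear_combination (2 * Real.pi * ξ : ℂ) ^ 2 * Complex.I_mul_I
    rw [this, Complex.norm_real, Real.norm_eq_abs, abs_neg, abs_of_nonneg (sq_nonneg _)]
  have hlim := tendsto_norm_of_isMul (l := 𝓝[≠] (0 : ℝ)) (C := 2) hF (fun s ξ => by
    by_cases h : ξ = 0
    · simp [hq, h]
    simp only [hq, h, if_false]
    refine (norm_sub_le _ _).trans ?_
    rw [Complex.norm_I, norm_div, norm_mul, hn, Complex.norm_real]
    have hpos : 0 < (2 * Real.pi * ξ) ^ 2 := by positivity
    have h1 : ‖s⁻¹‖ * ‖propagatorSymbol s ξ - 1‖ / (2 * Real.pi * ξ) ^ 2 ≤ 1 := by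
      rw [div_le_one hpos]
      rcases eq_or_ne s 0 with rfl | hs
      · simpa using hpos.le
      · rw [norm_inv, Real.norm_eq_abs]
        have hs' : 0 < |s| := abs_pos.2 hs
        rw [inv_mul_le_iff₀ hs']
        exact norm_propagatorSymbol_sub_one_le s ξ
    linarith) (fun ξ => by
    by_cases h : ξ = 0
    · simp [hq, h]
    simp only [hq, h, if_false]
    have h1 := (hasDerivAt_propagatorSymbol_left ξ).tendsto_slope_zero
    have h2 := (h1.div_const ((2 * Real.pi * Complex.I * ξ : ℂ) ^ 2)).sub_const Complex.I
    have h3 : -(Complex.I * (((2 * Real.pi * ξ) ^ 2 : ℝ) : ℂ)) /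
        (2 * Real.pi * Complex.I * ξ : ℂ) ^ 2 - Complex.I = 0 := by
      rw [sub_eq_zero, div_eq_iff (pow_ne_zero 2 (hne ξ h))]
      push_cast
      linear_combination (-4 * (Real.pi : ℂ) ^ 2 * ξ ^ 2 * Complex.I) * Complex.I_mul_I
    rw [h3] at h2
    simpa [propagatorSymbol_zero] using h2)
  simpa only [Lp.norm_fourier_eq] using hlim

theorem hasDerivAt_propagator {f f2 : L2} (hf : IsWeakDeriv 2 f f2) (r : ℝ) :
    HasDerivAt (fun r => propagator r f) (Complex.I • propagator r f2) r := by
  rw [hasDerivAt_iff_tendsto_slope_zero, tendsto_iff_norm_sub_tendsto_zero]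
  refine (tendsto_propagator_slope (hf.propagator r)).congr fun s => ?_
  rw [propagator_propagator, add_comm r s, Complex.coe_smul]
  rfl

/-! ### Classical representatives of Sobolev functions -/

/-- The inverse transform on L² agrees with the integral formula because both are adjoint to the
same transform on test functions. -/
theorem fourierInv_coeFn_ae_eq {H : L2} (hH : Integrable (fun x => H x)) :
    (fun x => (𝓕⁻ H : L2) x) =ᵐ[volume] 𝓕⁻ (fun x => H x) := by
  have hcont : Continuous (𝓕⁻ (fun x => H x) : ℝ → ℂ) :=
    VectorFourier.fourierIntegral_continuous Real.continuous_fourierChar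
      (by
      simp only [LinearMap.neg_apply, innerₗ_apply_apply]
      exact continuous_inner.neg) hH
  refine ae_eq_of_integral_contDiff_smul_eq
    ((Lp.memLp (𝓕⁻ H : L2)).locallyIntegrable (by norm_num)) hcont.locallyIntegrable
    fun φ hφ hc => ?_
  have hg₁ : HasCompactSupport (Complex.ofRealCLM ∘ φ) := hc.comp_left rfl
  have hg₂ : ContDiff ℝ (⊤ : ℕ∞) (Complex.ofRealCLM ∘ φ) := by fun_prop
  have h1 := DFunLike.congr_fun (Lp.fourierInv_toTemperedDistribution_eq H)
    (hg₁.toSchwartzMap hg₂)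
  rw [TemperedDistribution.fourierInv_apply, Lp.toTemperedDistribution_apply,
    Lp.toTemperedDistribution_apply] at h1
  have h2 : ∫ x, φ x • (𝓕⁻ H : L2) x = ∫ x, (hg₁.toSchwartzMap hg₂) x • (𝓕⁻ H : L2) x := by
    simp
  have h3 : ∫ x, φ x • (𝓕⁻ (fun x => H x) : ℝ → ℂ) x =
      ∫ x, (hg₁.toSchwartzMap hg₂) x • (𝓕⁻ (fun x => H x) : ℝ → ℂ) x := by simp
  rw [h2, h3, ← h1, SchwartzMap.fourierInv_coe]
  have hflip : (-innerₗ ℝ).flip = -innerₗ ℝ := by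
    ext; simp
  have := VectorFourier.integral_fourierIntegral_smul_eq_flip (L := -innerₗ ℝ)
    (μ := volume) (ν := volume)
    Real.continuous_fourierChar (by
      simp only [LinearMap.neg_apply, innerₗ_apply_apply]
      exact continuous_inner.neg)
    (hg₁.toSchwartzMap hg₂).integrable hH
  rw [hflip] at this
  exact this

/-! ### The embedding of H² into C¹ functions and integration by parts. -/

theorem memLp_inv_one_add_sq : MemLp (fun ξ : ℝ => (1 + ξ ^ 2)⁻¹) 2 volume := by
  have hc : Continuous fun ξ : ℝ => (1 + ξ ^ 2)⁻¹ := by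
    refine Continuous.inv₀ (by fun_prop) fun x => by positivity
  rw [memLp_two_iff_integrable_sq hc.aestronglyMeasurable]
  refine integrable_inv_one_add_sq.mono' (hc.pow 2).aestronglyMeasurable (ae_of_all _ fun ξ => ?_)
  rw [Real.norm_of_nonneg (by positivity), sq]
  have : (1 + ξ ^ 2)⁻¹ ≤ 1 := inv_le_one_of_one_le₀ (by nlinarith [sq_nonneg ξ])
  exact mul_le_of_le_one_left (by positivity) this

theorem memLp_mul_inv_one_add_sq : MemLp (fun ξ : ℝ => ξ * (1 + ξ ^ 2)⁻¹) 2 volume := by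
  have hc : Continuous fun ξ : ℝ => ξ * (1 + ξ ^ 2)⁻¹ := by
    refine continuous_id.mul (Continuous.inv₀ (by fun_prop) fun x => by positivity)
  rw [memLp_two_iff_integrable_sq hc.aestronglyMeasurable]
  refine integrable_inv_one_add_sq.mono' (hc.pow 2).aestronglyMeasurable (ae_of_all _ fun ξ => ?_)
  rw [Real.norm_of_nonneg (by positivity), mul_pow]
  have h0 : 0 < 1 + ξ ^ 2 := by positivity
  have : ξ ^ 2 * (1 + ξ ^ 2)⁻¹ ≤ 1 := by
    rw [mul_inv_le_iff₀ h0]; linarith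
  calc ξ ^ 2 * ((1 + ξ ^ 2)⁻¹) ^ 2 = (ξ ^ 2 * (1 + ξ ^ 2)⁻¹) * (1 + ξ ^ 2)⁻¹ := by ring
    _ ≤ _ := mul_le_of_le_one_left (by positivity) this

/-- The constant of the embedding of `H²(ℝ)` into the bounded functions. -/
def sobolevConst : ℝ := (∫ ξ : ℝ, ((1 + ξ ^ 2)⁻¹) ^ (2 : ℝ)) ^ (1 / (2 : ℝ))

theorem integral_weight_mul_norm_le (f : L2) :
    ∫ ξ : ℝ, (1 + ξ ^ 2)⁻¹ * ‖f ξ‖ ≤ sobolevConst * ‖f‖ := by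
  have h2 : ENNReal.ofReal 2 = 2 := by norm_num
  have h := integral_mul_le_Lp_mul_Lq_of_nonneg (μ := (volume : Measure ℝ))
    (p := 2) (q := 2) Real.HolderConjugate.two_two
    (f := fun ξ : ℝ => (1 + ξ ^ 2)⁻¹) (g := fun ξ => ‖f ξ‖)
    (ae_of_all _ fun ξ => by positivity) (ae_of_all _ fun ξ => norm_nonneg _)
    (by rw [h2]; exact memLp_inv_one_add_sq) (by rw [h2]; exact (Lp.memLp f).norm)
  refine h.trans_eq ?_
  rw [sobolevConst]
  congr 1
  simp_rw [Real.rpow_two]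
  rw [← norm_sq_eq_integral, ← Real.sqrt_eq_rpow, Real.sqrt_sq (norm_nonneg f)]

/-- Two derivatives in L² make both the transform of f and ξ times it integrable, by Cauchy–Schwarz
against (1+ξ²)⁻¹ and ξ(1+ξ²)⁻¹. Fourier inversion may then be differentiated under the integral. -/
theorem exists_classical {f f1 f2 : L2} (h1 : IsWeakDeriv 1 f f1) (h2 : IsWeakDeriv 2 f f2) :
    ∃ F F1 : ℝ → ℂ, (∀ᵐ x, f x = F x) ∧ (∀ᵐ x, f1 x = F1 x) ∧
      (∀ x, HasDerivAt F (F1 x) x) ∧ ∀ x, ‖F x‖ ≤ sobolevConst * (‖f‖ + ‖f2‖) := by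
  rw [isWeakDeriv_iff_fourier] at h1 h2
  have hb : ∀ᵐ ξ, (1 + ξ ^ 2) * ‖(𝓕 f : L2) ξ‖ ≤ ‖(𝓕 f : L2) ξ‖ + ‖(𝓕 f2 : L2) ξ‖ := by
    filter_upwards [h2] with ξ h
    rw [h, norm_mul]
    have hn : ‖(2 * Real.pi * Complex.I * ξ : ℂ) ^ 2‖ = (2 * Real.pi) ^ 2 * ξ ^ 2 := by
      rw [norm_pow]
      simp [mul_pow, abs_of_pos Real.pi_pos]
    rw [hn, add_mul, one_mul]
    have : 1 ≤ (2 * Real.pi) ^ 2 := by nlinarith [Real.pi_gt_three]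
    have h3 : ξ ^ 2 ≤ (2 * Real.pi) ^ 2 * ξ ^ 2 := le_mul_of_one_le_left (sq_nonneg _) this
    gcongr
  have hint1 : Integrable fun ξ : ℝ => (1 + ξ ^ 2)⁻¹ * ‖(𝓕 f : L2) ξ‖ :=
    memLp_inv_one_add_sq.integrable_mul (Lp.memLp (𝓕 f : L2)).norm
  have hint2 : Integrable fun ξ : ℝ => (1 + ξ ^ 2)⁻¹ * ‖(𝓕 f2 : L2) ξ‖ :=
    memLp_inv_one_add_sq.integrable_mul (Lp.memLp (𝓕 f2 : L2)).norm
  have hb' : ∀ᵐ ξ, ‖(𝓕 f : L2) ξ‖ ≤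
      (1 + ξ ^ 2)⁻¹ * ‖(𝓕 f : L2) ξ‖ + (1 + ξ ^ 2)⁻¹ * ‖(𝓕 f2 : L2) ξ‖ := by
    filter_upwards [hb] with ξ h
    have h0 : 0 < 1 + ξ ^ 2 := by positivity
    rw [← mul_add, le_inv_mul_iff₀ h0]
    exact h
  have hf : Integrable fun ξ => (𝓕 f : L2) ξ :=
    (hint1.add hint2).mono' (Lp.memLp (𝓕 f : L2)).1 hb'
  have hint3 : Integrable fun ξ : ℝ => ‖(ξ * (1 + ξ ^ 2)⁻¹) * ‖(𝓕 f : L2) ξ‖‖ :=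
    (memLp_mul_inv_one_add_sq.integrable_mul (Lp.memLp (𝓕 f : L2)).norm).norm
  have hint4 : Integrable fun ξ : ℝ => ‖(ξ * (1 + ξ ^ 2)⁻¹) * ‖(𝓕 f2 : L2) ξ‖‖ :=
    (memLp_mul_inv_one_add_sq.integrable_mul (Lp.memLp (𝓕 f2 : L2)).norm).norm
  have hxf : Integrable fun ξ : ℝ => ξ • (𝓕 f : L2) ξ := by
    refine (hint3.add hint4).mono' (continuous_id.aestronglyMeasurable.smul
      (Lp.memLp (𝓕 f : L2)).1) ?_
    filter_upwards [hb'] with ξ h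
    simp only [Pi.add_apply, norm_mul, norm_smul, norm_norm]
    rw [Real.norm_of_nonneg (by positivity : 0 ≤ (1 + ξ ^ 2)⁻¹), mul_assoc, mul_assoc, ← mul_add]
    gcongr
  have hf1 : Integrable fun ξ => (𝓕 f1 : L2) ξ := by
    refine (hxf.const_mul (2 * Real.pi * Complex.I)).congr ?_
    filter_upwards [h1] with ξ h
    rw [h, pow_one, Complex.real_smul]
    ring
  refine ⟨𝓕⁻ (fun ξ => (𝓕 f : L2) ξ), 𝓕⁻ (fun ξ => (𝓕 f1 : L2) ξ), ?_, ?_, fun x => ?_,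
    fun x => ?_⟩
  · have h := fourierInv_coeFn_ae_eq hf
    rwa [FourierTransform.fourierInv_fourier_eq] at h
  · have h := fourierInv_coeFn_ae_eq hf1
    rwa [FourierTransform.fourierInv_fourier_eq] at h
  · have hd := Real.hasDerivAt_fourier hf hxf (-x)
    have hd2 := hd.scomp x (hasDerivAt_neg x)
    have e1 : (𝓕⁻ (fun ξ => (𝓕 f : L2) ξ) : ℝ → ℂ) = 𝓕 (fun ξ => (𝓕 f : L2) ξ) ∘ Neg.neg := by
      ext y; rw [Real.fourierInv_eq_fourier_neg]; rfl
    rw [e1]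
    refine hd2.congr_deriv ?_
    rw [Real.fourierInv_eq_fourier_neg, neg_one_smul, Real.fourier_eq, Real.fourier_eq,
      ← integral_neg]
    apply integral_congr_ae
    filter_upwards [h1] with ξ h
    rw [h, ← smul_neg]
    congr 1
    simp only [smul_eq_mul]
    ring
  · calc ‖(𝓕⁻ (fun ξ => (𝓕 f : L2) ξ) : ℝ → ℂ) x‖ ≤ ∫ ξ, ‖(𝓕 f : L2) ξ‖ :=
          VectorFourier.norm_fourierIntegral_le_integral_norm _ _ _ _ _
      _ ≤ ∫ ξ : ℝ, ((1 + ξ ^ 2)⁻¹ * ‖(𝓕 f : L2) ξ‖ + (1 + ξ ^ 2)⁻¹ * ‖(𝓕 f2 : L2) ξ‖) :=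
          integral_mono_ae hf.norm (hint1.add hint2) hb'
      _ ≤ sobolevConst * ‖(𝓕 f : L2)‖ + sobolevConst * ‖(𝓕 f2 : L2)‖ := by
          rw [integral_add hint1 hint2]
          exact add_le_add (integral_weight_mul_norm_le _) (integral_weight_mul_norm_le _)
      _ = _ := by rw [Lp.norm_fourier_eq, Lp.norm_fourier_eq, mul_add]

theorem ae_norm_le_of_isWeakDeriv {f f2 : L2} (h2 : IsWeakDeriv 2 f f2) :
    ∀ᵐ x, ‖f x‖ ≤ sobolevConst * (‖f‖ + ‖f2‖) := by
  obtain ⟨f1, h1, -⟩ := exists_isWeakDeriv_of_le (j := 1) (by norm_num) h2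
  obtain ⟨F, F1, hF, -, -, hle⟩ := exists_classical h1 h2
  filter_upwards [hF] with x hx
  rw [hx]
  exact hle x

/-- Integration by parts with a weight, for functions with classical derivatives. -/
theorem integral_weight_parts {a a' : ℝ → ℝ} {F F1 G G1 : ℝ → ℂ}
    (ha : ∀ x, HasDerivAt a (a' x) x) (hF : ∀ x, HasDerivAt F (F1 x) x)
    (hG : ∀ x, HasDerivAt G (G1 x) x) (h0 : Integrable fun x => (a x : ℂ) * (G x * conj (F x)))
    (h1 : Integrable fun x => (a' x : ℂ) * (G x * conj (F x)))
    (h2 : Integrable fun x => (a x : ℂ) * (G1 x * conj (F x)))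
    (h3 : Integrable fun x => (a x : ℂ) * (G x * conj (F1 x))) :
    (∫ x, (a' x : ℂ) * (G x * conj (F x))) + (∫ x, (a x : ℂ) * (G1 x * conj (F x))) +
      ∫ x, (a x : ℂ) * (G x * conj (F1 x)) = 0 := by
  rw [← integral_add h1 h2, ← integral_add (by exact h1.add h2) h3]
  refine integral_eq_zero_of_hasDerivAt_of_integrable (fun x => ?_) ((h1.add h2).add h3) h0
  have hc : HasDerivAt (fun y => conj (F y)) (conj (F1 x)) x := (hF x).star
  refine ((ha x).ofReal_comp.mul ((hG x).mul hc)).congr_deriv ?_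
  simp only [Pi.mul_apply]
  ring

/-- Integration by parts with a weight, for functions with two weak derivatives. -/
theorem inner_weight_parts {a a' : ℝ → ℝ} (ha : ∀ x, HasDerivAt a (a' x) x)
    {f f1 f2 g g1 g2 : L2} (hf1 : IsWeakDeriv 1 f f1) (hf2 : IsWeakDeriv 2 f f2)
    (hg1 : IsWeakDeriv 1 g g1) (hg2 : IsWeakDeriv 2 g g2)
    (h0 : Integrable fun x => (a x : ℂ) * (g x * conj (f x)))
    (h1 : Integrable fun x => (a' x : ℂ) * (g x * conj (f x)))
    (h2 : Integrable fun x => (a x : ℂ) * (g1 x * conj (f x)))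
    (h3 : Integrable fun x => (a x : ℂ) * (g x * conj (f1 x))) :
    (∫ x, (a' x : ℂ) * (g x * conj (f x))) + (∫ x, (a x : ℂ) * (g1 x * conj (f x))) +
      ∫ x, (a x : ℂ) * (g x * conj (f1 x)) = 0 := by
  obtain ⟨F, F1, hF, hF1, hFd, -⟩ := exists_classical hf1 hf2
  obtain ⟨G, G1, hG, hG1, hGd, -⟩ := exists_classical hg1 hg2
  have e0 : (fun x => (a x : ℂ) * (g x * conj (f x))) =ᵐ[volume]
      fun x => (a x : ℂ) * (G x * conj (F x)) := by
    filter_upwards [hF, hG] with x h1 h2; rw [h1, h2]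
  have e1 : (fun x => (a' x : ℂ) * (g x * conj (f x))) =ᵐ[volume]
      fun x => (a' x : ℂ) * (G x * conj (F x)) := by
    filter_upwards [hF, hG] with x h1 h2; rw [h1, h2]
  have e2 : (fun x => (a x : ℂ) * (g1 x * conj (f x))) =ᵐ[volume]
      fun x => (a x : ℂ) * (G1 x * conj (F x)) := by
    filter_upwards [hF, hG1] with x h1 h2; rw [h1, h2]
  have e3 : (fun x => (a x : ℂ) * (g x * conj (f1 x))) =ᵐ[volume]
      fun x => (a x : ℂ) * (G x * conj (F1 x)) := by
    filter_upwards [hF1, hG] with x h1 h2; rw [h1, h2]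
  rw [integral_congr_ae e1, integral_congr_ae e2, integral_congr_ae e3]
  exact integral_weight_parts ha hFd hGd (h0.congr e0) (h1.congr e1) (h2.congr e2) (h3.congr e3)

/-! ### Weighted Sobolev spaces -/

theorem exists_isMul_of_bounded {a : ℝ → ℂ} (ha : Continuous a) {C : ℝ} (hC : ∀ x, ‖a x‖ ≤ C)
    (f : L2) : ∃ g, IsMul a f g :=
  exists_isMul ((Lp.memLp f).of_le_mul (c := C) (ha.aestronglyMeasurable.mul (Lp.memLp f).1)
    (ae_of_all _ fun x => by
      rw [norm_mul]
      exact mul_le_mul_of_nonneg_right (hC x) (norm_nonneg _)))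

theorem IsMul.norm_le {a b : ℝ → ℂ} {f g h k : L2} (hg : IsMul a f g) (hk : IsMul b h k)
    (hab : ∀ᵐ x, ‖a x * f x‖ ≤ ‖b x * h x‖) : ‖g‖ ≤ ‖k‖ := by
  apply Lp.norm_le_norm_of_ae_le
  filter_upwards [hg, hk, hab] with x h1 h2 h3
  rw [h1, h2]
  exact h3

theorem isMul_one (f : L2) : IsMul (fun _ => 1) f f := ae_of_all _ fun _ => (one_mul _).symm

theorem IsMul.integrable_mul_conj {a : ℝ → ℂ} {f g : L2} (hg : IsMul a f g) (h : L2) :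
    Integrable fun x => a x * (f x * conj (h x)) := by
  refine (DMNLS.integrable_mul_conj h g).congr ?_
  filter_upwards [hg] with x hx
  rw [hx, mul_assoc]

theorem IsMul.integral_eq_inner {a : ℝ → ℂ} {f g : L2} (hg : IsMul a f g) (h : L2) :
    ∫ x, a x * (f x * conj (h x)) = inner ℂ h g := by
  rw [inner_eq_integral]
  apply integral_congr_ae
  filter_upwards [hg] with x hx
  rw [hx, mul_assoc]

/-- A bounded approximation of the identity function. -/
def cutoff (ε x : ℝ) : ℝ := x / (1 + ε * x ^ 2)

/-- The derivative of `cutoff`. -/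
def cutoffDeriv (ε x : ℝ) : ℝ := (1 - ε * x ^ 2) / (1 + ε * x ^ 2) ^ 2

theorem hasDerivAt_cutoff {ε : ℝ} (hε : 0 ≤ ε) (x : ℝ) :
    HasDerivAt (cutoff ε) (cutoffDeriv ε x) x := by
  have h0 : 0 < 1 + ε * x ^ 2 := by positivity
  have h1 : HasDerivAt (fun x : ℝ => 1 + ε * x ^ 2) (ε * (2 * x)) x := by
    simpa using (((hasDerivAt_id' x).fun_pow 2).const_mul ε).const_add 1
  refine ((hasDerivAt_id' x).fun_div h1 h0.ne').congr_deriv ?_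
  rw [cutoffDeriv]
  congr 1
  ring

theorem continuous_cutoff {ε : ℝ} (hε : 0 ≤ ε) : Continuous (cutoff ε) :=
  continuous_iff_continuousAt.2 fun x => (hasDerivAt_cutoff hε x).continuousAt

theorem continuous_cutoffDeriv {ε : ℝ} (hε : 0 ≤ ε) : Continuous (cutoffDeriv ε) := by
  unfold cutoffDeriv
  exact Continuous.div (by fun_prop) (by fun_prop) fun x => by positivity

theorem abs_cutoff_le {ε : ℝ} (hε : 0 ≤ ε) (x : ℝ) : |cutoff ε x| ≤ |x| := by
  rw [cutoff, abs_div]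
  apply div_le_self (abs_nonneg x)
  rw [abs_of_pos (by positivity)]
  nlinarith [mul_nonneg hε (sq_nonneg x)]

theorem abs_cutoff_le_const {ε : ℝ} (hε : 0 < ε) (x : ℝ) : |cutoff ε x| ≤ 1 + ε⁻¹ := by
  have h0 : 0 < 1 + ε * x ^ 2 := by positivity
  rw [cutoff, abs_div, abs_of_pos h0, div_le_iff₀ h0]
  have h1 : (1 + ε⁻¹) * (1 + ε * x ^ 2) = 1 + ε⁻¹ + ε * x ^ 2 + x ^ 2 := by
    field_simp
    ring
  rw [h1]
  have : 0 < ε⁻¹ := by positivity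
  nlinarith [sq_nonneg (|x| - 1), sq_abs x, mul_nonneg hε.le (sq_nonneg x)]

theorem abs_cutoffDeriv_le {ε : ℝ} (hε : 0 ≤ ε) (x : ℝ) : |cutoffDeriv ε x| ≤ 1 := by
  have h0 := mul_nonneg hε (sq_nonneg x)
  rw [cutoffDeriv, abs_div, abs_of_pos (by positivity : 0 < (1 + ε * x ^ 2) ^ 2),
    div_le_one (by positivity), abs_le]
  constructor <;> nlinarith

/-- Integration by parts with the weight χ², χ = `cutoff ε`, gives ‖χf'‖² = −2⟨χ'f, χf'⟩ − ⟨χ²f,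
f''⟩. Since |χ| ≤ |x| and |χ'| ≤ 1, the resulting bound is independent of ε. The third derivative
serves only to give f' a classical representative. -/
theorem norm_cutoff_mul_deriv_le {ε : ℝ} (hε : 0 < ε) {f f1 f2 f3 h T : L2}
    (h1 : IsWeakDeriv 1 f f1) (h2 : IsWeakDeriv 2 f f2) (h3 : IsWeakDeriv 3 f f3)
    (hh : IsMul (fun x : ℝ => ((x ^ 2 : ℝ) : ℂ)) f h)
    (hT : IsMul (fun x : ℝ => (cutoff ε x : ℂ)) f1 T) : ‖T‖ ≤ 2 * ‖f‖ + ‖f2‖ + ‖h‖ := by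
  have hf2 : IsWeakDeriv 1 f1 f2 := h1.of_add h2
  have hf3 : IsWeakDeriv 2 f1 f3 := h1.of_add h3
  have hc := continuous_cutoff hε.le
  have hc' := continuous_cutoffDeriv hε.le
  obtain ⟨S, hS⟩ := exists_isMul_of_bounded (a := fun x : ℝ => (cutoffDeriv ε x : ℂ)) (C := 1)
    (by fun_prop) (fun x => by
      rw [Complex.norm_real]; exact abs_cutoffDeriv_le hε.le x) f
  obtain ⟨W, hW⟩ := exists_isMul_of_bounded (a := fun x : ℝ => ((cutoff ε x ^ 2 : ℝ) : ℂ))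
    (C := (1 + ε⁻¹) ^ 2) (by fun_prop) (fun x => by
      rw [Complex.norm_real, norm_pow]
      exact pow_le_pow_left₀ (norm_nonneg _) (abs_cutoff_le_const hε x) 2) f
  have hSle : ‖S‖ ≤ ‖f‖ := hS.norm_le (isMul_one f) (ae_of_all _ fun x => by
    rw [norm_mul, norm_mul, Complex.norm_real, norm_one]
    exact mul_le_mul_of_nonneg_right (abs_cutoffDeriv_le hε.le x) (norm_nonneg _))
  have hWle : ‖W‖ ≤ ‖h‖ := hW.norm_le hh (ae_of_all _ fun x => by
    rw [norm_mul, norm_mul, Complex.norm_real, Complex.norm_real, norm_pow, norm_pow]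
    exact mul_le_mul_of_nonneg_right
      (pow_le_pow_left₀ (norm_nonneg _) (abs_cutoff_le hε.le x) 2) (norm_nonneg _))
  have e1 : (fun x => ((2 * cutoff ε x * cutoffDeriv ε x : ℝ) : ℂ) * (f1 x * conj (f x)))
      =ᵐ[volume] fun x => 2 * (T x * conj (S x)) := by
    filter_upwards [hT, hS] with x h1 h2
    rw [h1, h2, map_mul, Complex.conj_ofReal]
    push_cast
    ring
  have e2 : (fun x => ((cutoff ε x ^ 2 : ℝ) : ℂ) * (f2 x * conj (f x)))
      =ᵐ[volume] fun x => f2 x * conj (W x) := by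
    filter_upwards [hW] with x h1
    rw [h1, map_mul, Complex.conj_ofReal]
    ring
  have e3 : (fun x => ((cutoff ε x ^ 2 : ℝ) : ℂ) * (f1 x * conj (f1 x)))
      =ᵐ[volume] fun x => T x * conj (T x) := by
    filter_upwards [hT] with x h1
    rw [h1, map_mul, Complex.conj_ofReal]
    push_cast
    ring
  have e0 : (fun x => ((cutoff ε x ^ 2 : ℝ) : ℂ) * (f1 x * conj (f x)))
      =ᵐ[volume] fun x => f1 x * conj (W x) := by
    filter_upwards [hW] with x h1
    rw [h1, map_mul, Complex.conj_ofReal]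
    ring
  have key := inner_weight_parts (a := fun x => cutoff ε x ^ 2)
    (a' := fun x => 2 * cutoff ε x * cutoffDeriv ε x)
    (fun x => by
      refine ((hasDerivAt_cutoff hε.le x).fun_pow 2).congr_deriv ?_
      norm_num) h1 h2 hf2 hf3 ((integrable_mul_conj W f1).congr e0.symm)
    (((integrable_mul_conj S T).const_mul 2).congr e1.symm)
    ((integrable_mul_conj W f2).congr e2.symm) ((integrable_mul_conj T T).congr e3.symm)
  rw [integral_congr_ae e1, integral_congr_ae e2, integral_congr_ae e3, integral_const_mul,
    ← inner_eq_integral, ← inner_eq_integral, ← inner_eq_integral,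
    inner_self_eq_norm_sq_to_K] at key
  have h5 : ((‖T‖ ^ 2 : ℝ) : ℂ) = -(2 * inner ℂ S T + inner ℂ W f2) := by
    push_cast
    linear_combination key
  have h6 : ‖T‖ ^ 2 ≤ 2 * (‖f‖ * ‖T‖) + ‖h‖ * ‖f2‖ := by
    have := congrArg norm h5
    rw [Complex.norm_real, Real.norm_of_nonneg (by positivity), norm_neg] at this
    rw [this]
    refine (norm_add_le _ _).trans ?_
    rw [norm_mul, Complex.norm_ofNat]
    have h7 := (norm_inner_le_norm (𝕜 := ℂ) S T).trans
      (mul_le_mul_of_nonneg_right hSle (norm_nonneg T))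
    have h8 := (norm_inner_le_norm (𝕜 := ℂ) W f2).trans
      (mul_le_mul_of_nonneg_right hWle (norm_nonneg f2))
    linarith
  -- The inequality T² ≤ 2FT + HG with nonnegative entries forces T ≤ 2F + G + H.
  by_contra! hlt
  nlinarith [norm_nonneg f, norm_nonneg f2, norm_nonneg h, norm_nonneg T,
    mul_nonneg (norm_nonneg f2) (norm_nonneg h), mul_nonneg (norm_nonneg f) (norm_nonneg f2),
    mul_nonneg (norm_nonneg f) (norm_nonneg h)]

/-- If `∂ₓ³ f` and `x² f` are square integrable, then so is `x ∂ₓ f`. -/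
theorem exists_isMul_deriv {f f1 f2 f3 h : L2} (h1 : IsWeakDeriv 1 f f1) (h2 : IsWeakDeriv 2 f f2)
    (h3 : IsWeakDeriv 3 f f3) (hh : IsMul (fun x : ℝ => ((x ^ 2 : ℝ) : ℂ)) f h) :
    ∃ m, IsMul (fun x : ℝ => (x : ℂ)) f1 m ∧ ‖m‖ ≤ 2 * ‖f‖ + ‖f2‖ + ‖h‖ := by
  set K := 2 * ‖f‖ + ‖f2‖ + ‖h‖ with hK
  have hK0 : 0 ≤ K := by positivity
  have hpos : ∀ n : ℕ, 0 < 1 / ((n : ℝ) + 1) := fun n => by positivity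
  have hbd : ∀ n : ℕ, eLpNorm (fun x => (cutoff (1 / ((n : ℝ) + 1)) x : ℂ) * f1 x) 2 volume ≤
      ENNReal.ofReal K := fun n => by
    have hc := continuous_cutoff (hpos n).le
    obtain ⟨T, hT⟩ := exists_isMul_of_bounded
      (a := fun x : ℝ => (cutoff (1 / ((n : ℝ) + 1)) x : ℂ))
      (C := 1 + (1 / ((n : ℝ) + 1))⁻¹) (by fun_prop) (fun x => by
        rw [Complex.norm_real]; exact abs_cutoff_le_const (hpos n) x) f1
    have := norm_cutoff_mul_deriv_le (hpos n) h1 h2 h3 hh hT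
    rw [← eLpNorm_congr_ae hT, ← Lp.enorm_def, ← ofReal_norm]
    exact ENNReal.ofReal_le_ofReal this
  -- Fatou's lemma along ε = 1/(n+1) passes the uniform bound to the limit weight x.
  have hlim := Lp.eLpNorm_lim_le_liminf_eLpNorm (p := 2) (μ := volume)
    (f := fun (n : ℕ) x => (cutoff (1 / ((n : ℝ) + 1)) x : ℂ) * f1 x)
    (fun n => (Complex.continuous_ofReal.comp
      (continuous_cutoff (hpos n).le)).aestronglyMeasurable.mul (Lp.memLp f1).1)
    (fun x => (x : ℂ) * f1 x) (ae_of_all _ fun x => by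
      have h : Tendsto (fun n : ℕ => cutoff (1 / ((n : ℝ) + 1)) x) atTop
          (𝓝 (x / (1 + 0 * x ^ 2))) :=
        tendsto_const_nhds.div
          ((tendsto_one_div_add_atTop_nhds_zero_nat.mul_const _).const_add 1) (by simp)
      rw [zero_mul, add_zero, div_one] at h
      exact ((Complex.continuous_ofReal.tendsto x).comp h).mul_const _)
  have hle : eLpNorm (fun x : ℝ => (x : ℂ) * f1 x) 2 volume ≤ ENNReal.ofReal K :=
    hlim.trans ((liminf_le_liminf (Eventually.of_forall hbd)).trans_eq (liminf_const _))
  have hm : MemLp (fun x : ℝ => (x : ℂ) * f1 x) 2 volume :=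
    ⟨Complex.continuous_ofReal.aestronglyMeasurable.mul (Lp.memLp f1).1,
      hle.trans_lt ENNReal.ofReal_lt_top⟩
  refine ⟨hm.toLp, hm.coeFn_toLp, ?_⟩
  rw [Lp.norm_toLp]
  exact ENNReal.toReal_le_of_le_ofReal hK0 hle

/-! ### Bounds by the norm of H^{k,k} and linearity of the totalized operators. -/

theorem IsMul.weightMul_eq {k : ℕ} {f g : L2} (h : IsMul (fun x : ℝ => ((x ^ k : ℝ) : ℂ)) f g) :
    weightMul k f = g := by
  have hm : MemLp (fun x : ℝ => ((x ^ k : ℝ) : ℂ) * f x) 2 volume := h.memLp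
  rw [weightMul, dif_pos hm]
  exact IsMul.unique (a := fun x : ℝ => ((x ^ k : ℝ) : ℂ)) hm.coeFn_toLp h

theorem norm_le_hkkNorm (k : ℕ) (f : L2) : ‖f‖ ≤ hkkNorm k f :=
  Real.le_sqrt_of_sq_le (by nlinarith [sq_nonneg ‖weakDeriv k f‖, sq_nonneg ‖weightMul k f‖])

theorem norm_weakDeriv_le_hkkNorm (k : ℕ) (f : L2) : ‖weakDeriv k f‖ ≤ hkkNorm k f :=
  Real.le_sqrt_of_sq_le (by nlinarith [sq_nonneg ‖f‖, sq_nonneg ‖weightMul k f‖])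

theorem norm_weightMul_le_hkkNorm (k : ℕ) (f : L2) : ‖weightMul k f‖ ≤ hkkNorm k f :=
  Real.le_sqrt_of_sq_le (by nlinarith [sq_nonneg ‖f‖, sq_nonneg ‖weakDeriv k f‖])

theorem MemHkk.isWeakDeriv_norm_le {j k : ℕ} (hjk : j ≤ k) {f : L2} (hf : MemHkk k f) :
    IsWeakDeriv j f (weakDeriv j f) ∧ ‖weakDeriv j f‖ ≤ 2 * hkkNorm k f := by
  obtain ⟨⟨h, hh⟩, -⟩ := hf
  obtain ⟨g, hg, hle⟩ := exists_isWeakDeriv_of_le hjk hh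
  rw [hg.weakDeriv_eq]
  refine ⟨hg, ?_⟩
  have h1 := norm_le_hkkNorm k f
  have h2 := norm_weakDeriv_le_hkkNorm k f
  rw [hh.weakDeriv_eq] at h2
  linarith

theorem MemHkk.isWeakDeriv {j k : ℕ} (hjk : j ≤ k) {f : L2} (hf : MemHkk k f) :
    IsWeakDeriv j f (weakDeriv j f) := (hf.isWeakDeriv_norm_le hjk).1

theorem MemHkk.isMul_norm_le {j k : ℕ} (hjk : j ≤ k) {f : L2} (hf : MemHkk k f) :
    IsMul (fun x : ℝ => ((x ^ j : ℝ) : ℂ)) f (weightMul j f) ∧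
      ‖weightMul j f‖ ≤ 2 * hkkNorm k f := by
  obtain ⟨-, hm⟩ := hf
  obtain ⟨h, hh⟩ := exists_isMul (a := fun x : ℝ => ((x ^ k : ℝ) : ℂ)) hm
  obtain ⟨g, hg, hle⟩ := exists_isMul_of_le (a := fun x : ℝ => ((x ^ j : ℝ) : ℂ)) (by fun_prop) hh
    (fun x => by
      rw [Complex.norm_real, Complex.norm_real, norm_pow, norm_pow]
      rcases le_total ‖x‖ 1 with h | h
      · have := pow_le_one₀ (n := j) (norm_nonneg _) h
        have := pow_nonneg (norm_nonneg x) k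
        linarith
      · have := pow_le_pow_right₀ h hjk
        linarith)
  rw [hg.weightMul_eq]
  refine ⟨hg, ?_⟩
  have h1 := norm_le_hkkNorm k f
  have h2 := norm_weightMul_le_hkkNorm k f
  rw [hh.weightMul_eq] at h2
  linarith

theorem MemHkk.isMul {j k : ℕ} (hjk : j ≤ k) {f : L2} (hf : MemHkk k f) :
    IsMul (fun x : ℝ => ((x ^ j : ℝ) : ℂ)) f (weightMul j f) := (hf.isMul_norm_le hjk).1

theorem MemHkk.isMul_deriv_norm_le {f : L2} (hf : MemHkk 3 f) :
    IsMul (fun x : ℝ => (x : ℂ)) (weakDeriv 1 f) (weightMul 1 (weakDeriv 1 f)) ∧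
      ‖weightMul 1 (weakDeriv 1 f)‖ ≤ 6 * hkkNorm 3 f := by
  obtain ⟨m, hm, hle⟩ := exists_isMul_deriv (hf.isWeakDeriv (j := 1) (by norm_num))
    (hf.isWeakDeriv (j := 2) (by norm_num)) (hf.isWeakDeriv (j := 3) le_rfl)
    (hf.isMul (j := 2) (by norm_num))
  have hm' : weightMul 1 (weakDeriv 1 f) = m := IsMul.weightMul_eq (by simpa using hm)
  rw [hm']
  refine ⟨hm, ?_⟩
  -- The constant 6 is 2 + 2 + 2, one summand for each term of the bound 2‖f‖ + ‖∂ₓ²f‖ + ‖x²f‖.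
  have h1 := norm_le_hkkNorm 3 f
  have h2 := (hf.isWeakDeriv_norm_le (j := 2) (by norm_num)).2
  have h3 := (hf.isMul_norm_le (j := 2) (by norm_num)).2
  linarith

theorem MemHkk.isMul_deriv {f : L2} (hf : MemHkk 3 f) :
    IsMul (fun x : ℝ => (x : ℂ)) (weakDeriv 1 f) (weightMul 1 (weakDeriv 1 f)) :=
  hf.isMul_deriv_norm_le.1

theorem MemHkk.sub {k : ℕ} {f g : L2} (hf : MemHkk k f) (hg : MemHkk k g) : MemHkk k (f - g) :=
  ⟨⟨_, (hf.isWeakDeriv le_rfl).sub (hg.isWeakDeriv le_rfl)⟩,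
    ((hf.isMul le_rfl).sub (hg.isMul le_rfl)).memLp⟩

theorem MemHkk.weakDeriv_sub {j k : ℕ} (hjk : j ≤ k) {f g : L2} (hf : MemHkk k f)
    (hg : MemHkk k g) : weakDeriv j (f - g) = weakDeriv j f - weakDeriv j g :=
  ((hf.isWeakDeriv hjk).sub (hg.isWeakDeriv hjk)).weakDeriv_eq

theorem MemHkk.weightMul_sub {j k : ℕ} (hjk : j ≤ k) {f g : L2} (hf : MemHkk k f)
    (hg : MemHkk k g) : weightMul j (f - g) = weightMul j f - weightMul j g :=
  ((hf.isMul hjk).sub (hg.isMul hjk)).weightMul_eq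

theorem MemHkk.weightMul_weakDeriv_sub {f g : L2} (hf : MemHkk 3 f) (hg : MemHkk 3 g) :
    weightMul 1 (weakDeriv 1 (f - g)) =
      weightMul 1 (weakDeriv 1 f) - weightMul 1 (weakDeriv 1 g) := by
  rw [hf.weakDeriv_sub (by norm_num) hg]
  exact IsMul.weightMul_eq (by simpa using hf.isMul_deriv.sub hg.isMul_deriv)

/-! ### The power nonlinearity -/

theorem rpow_tangent_le {q s t : ℝ} (hq : 1 < q) (hs : 0 ≤ s) (ht : 0 ≤ t) :
    s ^ q + q * s ^ (q - 1) * (t - s) ≤ t ^ q := by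
  rcases hs.eq_or_lt with rfl | hs
  · rw [Real.zero_rpow (by linarith), Real.zero_rpow (by linarith)]
    simpa using Real.rpow_nonneg ht q
  -- The tangent line inequality is Bernoulli's inequality at t/s, rescaled by s^q.
  · have h := one_add_mul_self_le_rpow_one_add (s := t / s - 1) (by
      have : 0 ≤ t / s := by positivity
      linarith) hq.le
    rw [add_sub_cancel, Real.div_rpow ht hs.le, le_div_iff₀ (by positivity)] at h
    refine le_trans (le_of_eq ?_) h
    rw [Real.rpow_sub_one hs.ne']
    field_simp

theorem abs_rpow_sub_rpow_le {q s t M : ℝ} (hq : 1 < q) (hs : 0 ≤ s) (ht : 0 ≤ t) (hsM : s ≤ M)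
    (htM : t ≤ M) : |s ^ q - t ^ q| ≤ q * M ^ (q - 1) * |s - t| := by
  wlog hst : t ≤ s generalizing s t
  · rw [abs_sub_comm, abs_sub_comm s]
    exact this ht hs htM hsM (le_of_not_ge hst)
  have h1 := rpow_tangent_le hq hs ht
  have h2 : s ^ (q - 1) ≤ M ^ (q - 1) := Real.rpow_le_rpow hs hsM (by linarith)
  rw [abs_of_nonneg (sub_nonneg.2 (Real.rpow_le_rpow ht hst (by linarith))),
    abs_of_nonneg (sub_nonneg.2 hst)]
  have h3 : q * s ^ (q - 1) * (s - t) ≤ q * M ^ (q - 1) * (s - t) := by gcongr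
  linarith

theorem norm_power_sub_power_le {p M : ℝ} (hp : 2 < p) {a b : ℂ} (ha : ‖a‖ ≤ M) (hb : ‖b‖ ≤ M) :
    ‖((‖a‖ ^ (p - 1) : ℝ) : ℂ) * a - ((‖b‖ ^ (p - 1) : ℝ) : ℂ) * b‖ ≤
      p * M ^ (p - 1) * ‖a - b‖ := by
  have hM : 0 ≤ M := (norm_nonneg a).trans ha
  have e : ((‖a‖ ^ (p - 1) : ℝ) : ℂ) * a - ((‖b‖ ^ (p - 1) : ℝ) : ℂ) * b =
      ((‖a‖ ^ (p - 1) : ℝ) : ℂ) * (a - b) + ((‖a‖ ^ (p - 1) - ‖b‖ ^ (p - 1) : ℝ) : ℂ) * b := by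
    push_cast
    ring
  rw [e]
  refine (norm_add_le _ _).trans ?_
  rw [norm_mul, norm_mul, Complex.norm_real, Complex.norm_real,
    Real.norm_of_nonneg (Real.rpow_nonneg (norm_nonneg a) _), Real.norm_eq_abs]
  have h1 : ‖a‖ ^ (p - 1) ≤ M ^ (p - 1) := Real.rpow_le_rpow (norm_nonneg a) ha (by linarith)
  have h2 := abs_rpow_sub_rpow_le (q := p - 1) (by linarith) (norm_nonneg a) (norm_nonneg b) ha hb
  have h3 := abs_norm_sub_norm_le a b
  have h4 : M ^ (p - 1 - 1) * M = M ^ (p - 1) := by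
    rcases hM.eq_or_lt with rfl | hM
    · rw [mul_zero, Real.zero_rpow (by linarith)]
    · rw [Real.rpow_sub_one hM.ne' (p - 1), div_mul_cancel₀ _ hM.ne']
  have h5 : (0 : ℝ) ≤ M ^ (p - 1 - 1) := Real.rpow_nonneg hM _
  calc ‖a‖ ^ (p - 1) * ‖a - b‖ + |‖a‖ ^ (p - 1) - ‖b‖ ^ (p - 1)| * ‖b‖
      ≤ M ^ (p - 1) * ‖a - b‖ + ((p - 1) * M ^ (p - 1 - 1) * ‖a - b‖) * M := by
        have h6 : (p - 1) * M ^ (p - 1 - 1) * |‖a‖ - ‖b‖| ≤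
            (p - 1) * M ^ (p - 1 - 1) * ‖a - b‖ :=
          mul_le_mul_of_nonneg_left h3 (mul_nonneg (by linarith) h5)
        have := mul_le_mul (h2.trans h6) hb (norm_nonneg b)
          (mul_nonneg (mul_nonneg (by linarith) h5) (norm_nonneg _))
        have := mul_le_mul_of_nonneg_right h1 (norm_nonneg (a - b))
        linarith
    _ = p * M ^ (p - 1) * ‖a - b‖ := by
        linear_combination (p - 1) * ‖a - b‖ * h4

/-- Convexity of z ↦ |z|^{p+1}, whose real gradient is (p+1)|a|^{p-1}a: the tangent inequality for
moduli combined with Re(b ā) ≤ |b||a|. -/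
theorem power_convex {p : ℝ} (hp : 0 < p) (a b : ℂ) :
    (p + 1) * ((b - a) * conj (((‖a‖ ^ (p - 1) : ℝ) : ℂ) * a)).re ≤
      ‖b‖ ^ (p + 1) - ‖a‖ ^ (p + 1) := by
  have h1 := rpow_tangent_le (q := p + 1) (by linarith) (norm_nonneg a) (norm_nonneg b)
  rw [add_sub_cancel_right] at h1
  have h2 : ((b - a) * conj (((‖a‖ ^ (p - 1) : ℝ) : ℂ) * a)).re ≤ ‖a‖ ^ p * (‖b‖ - ‖a‖) := by
    have e : (b - a) * conj (((‖a‖ ^ (p - 1) : ℝ) : ℂ) * a) =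
        ((‖a‖ ^ (p - 1) : ℝ) : ℂ) * (b * conj a - ((‖a‖ ^ 2 : ℝ) : ℂ)) := by
      have h4 : a * conj a = ((‖a‖ ^ 2 : ℝ) : ℂ) := by
        rw [Complex.mul_conj, Complex.normSq_eq_norm_sq]
      rw [map_mul, Complex.conj_ofReal, ← h4]
      ring
    rw [e, Complex.re_ofReal_mul, Complex.sub_re, Complex.ofReal_re]
    have h3 : (b * conj a).re ≤ ‖b‖ * ‖a‖ := (Complex.re_le_norm _).trans (by simp)
    have h5 : ‖a‖ ^ p * (‖b‖ - ‖a‖) = ‖a‖ ^ (p - 1) * (‖b‖ * ‖a‖ - ‖a‖ ^ 2) := by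
      rcases (norm_nonneg a).eq_or_lt with h | h
      · rw [← h, Real.zero_rpow hp.ne']; ring
      · rw [Real.rpow_sub_one h.ne']
        field_simp
    rw [h5]
    exact mul_le_mul_of_nonneg_left (by linarith) (Real.rpow_nonneg (norm_nonneg a) _)
  have h6 := mul_le_mul_of_nonneg_left h2 (by linarith : 0 ≤ p + 1)
  linarith

theorem aestronglyMeasurable_norm_rpow (q : ℝ) (v : L2) :
    AEStronglyMeasurable (fun x => ‖v x‖ ^ q) volume :=
  ((Lp.memLp v).1.norm.aemeasurable.pow_const q).aestronglyMeasurable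

theorem memLp_power {p M : ℝ} (hp : 1 ≤ p) {v : L2} (hv : ∀ᵐ x, ‖v x‖ ≤ M) :
    MemLp (fun x : ℝ => ((‖v x‖ ^ (p - 1) : ℝ) : ℂ) * v x) 2 volume := by
  refine (Lp.memLp v).of_le_mul (c := M ^ (p - 1))
    ((Complex.continuous_ofReal.comp_aestronglyMeasurable
    (aestronglyMeasurable_norm_rpow (p - 1) v)).mul (Lp.memLp v).1) ?_
  filter_upwards [hv] with x hx
  rw [norm_mul, Complex.norm_real, Real.norm_of_nonneg (Real.rpow_nonneg (norm_nonneg _) _)]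
  exact mul_le_mul_of_nonneg_right (Real.rpow_le_rpow (norm_nonneg _) hx (by linarith))
    (norm_nonneg _)

theorem coeFn_powerNL {p M : ℝ} (hp : 1 ≤ p) {v : L2} (hv : ∀ᵐ x, ‖v x‖ ≤ M) :
    ∀ᵐ x, powerNL p v x = ((‖v x‖ ^ (p - 1) : ℝ) : ℂ) * v x := by
  rw [powerNL, dif_pos (memLp_power hp hv)]
  exact (memLp_power hp hv).coeFn_toLp

theorem norm_rpow_add_one {p : ℝ} (hp : 1 < p) (a : ℂ) :
    ‖a‖ ^ (p + 1) = ‖a‖ ^ (p - 1) * ‖a‖ ^ 2 := by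
  rw [← Real.rpow_natCast, ← Real.rpow_add' (norm_nonneg a)]
  · norm_num
    ring_nf
  · norm_num
    linarith

theorem integrable_norm_rpow {p M : ℝ} (hp : 1 < p) {v : L2} (hv : ∀ᵐ x, ‖v x‖ ≤ M) :
    Integrable (fun x : ℝ => ‖v x‖ ^ (p + 1)) := by
  refine ((integrable_norm_sq v).const_mul (M ^ (p - 1))).mono'
    (aestronglyMeasurable_norm_rpow (p + 1) v) ?_
  filter_upwards [hv] with x hx
  rw [Real.norm_of_nonneg (Real.rpow_nonneg (norm_nonneg _) _), norm_rpow_add_one hp]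
  exact mul_le_mul_of_nonneg_right (Real.rpow_le_rpow (norm_nonneg _) hx (by linarith))
    (sq_nonneg _)

/-- `∫ |v|^{p+1}`. -/
def powerIntegral (p : ℝ) (v : L2) : ℝ := ∫ x : ℝ, ‖v x‖ ^ (p + 1)

theorem powerIntegral_nonneg (p : ℝ) (v : L2) : 0 ≤ powerIntegral p v :=
  integral_nonneg fun _ => Real.rpow_nonneg (norm_nonneg _) _

theorem powerIntegral_convex {p M : ℝ} (hp : 1 < p) {a b : L2} (ha : ∀ᵐ x, ‖a x‖ ≤ M)
    (hb : ∀ᵐ x, ‖b x‖ ≤ M) : (p + 1) * (inner ℂ (powerNL p a) (b - a)).re ≤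
      powerIntegral p b - powerIntegral p a := by
  have hi := integrable_mul_conj (powerNL p a) (b - a)
  rw [inner_eq_integral, powerIntegral, powerIntegral,
    ← integral_sub (integrable_norm_rpow hp hb) (integrable_norm_rpow hp ha)]
  have hre : (∫ x, (b - a : L2) x * conj (powerNL p a x)).re =
      ∫ x, ((b - a : L2) x * conj (powerNL p a x)).re := by
    have := integral_re (𝕜 := ℂ) hi
    simpa using this.symm
  rw [hre, ← integral_const_mul]
  refine integral_mono_ae (hi.re.const_mul (p + 1))
    ((integrable_norm_rpow hp hb).sub (integrable_norm_rpow hp ha)) ?_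
  filter_upwards [coeFn_powerNL hp.le ha, Lp.coeFn_sub b a] with x h1 h2
  simp only [h1, h2, Pi.sub_apply]
  exact power_convex (by linarith) (a x) (b x)

theorem norm_powerNL_sub_le {p M : ℝ} (hp : 2 < p) {a b : L2} (ha : ∀ᵐ x, ‖a x‖ ≤ M)
    (hb : ∀ᵐ x, ‖b x‖ ≤ M) : ‖powerNL p a - powerNL p b‖ ≤ p * M ^ (p - 1) * ‖a - b‖ := by
  apply Lp.norm_le_mul_norm_of_ae_le_mul
  filter_upwards [coeFn_powerNL (p := p) (by linarith) ha, coeFn_powerNL (p := p) (by linarith) hb,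
    Lp.coeFn_sub (powerNL p a) (powerNL p b), Lp.coeFn_sub a b, ha, hb] with x h1 h2 h3 h4 h5 h6
  rw [h3, Pi.sub_apply, h4, Pi.sub_apply, h1, h2]
  exact norm_power_sub_power_le hp h5 h6

theorem inner_powerNL_self {p M : ℝ} (hp : 1 < p) {v : L2} (hv : ∀ᵐ x, ‖v x‖ ≤ M) :
    inner ℂ (powerNL p v) v = powerIntegral p v := by
  rw [inner_eq_integral, powerIntegral, ← integral_complex_ofReal]
  apply integral_congr_ae
  filter_upwards [coeFn_powerNL hp.le hv] with x h
  rw [h, map_mul, Complex.conj_ofReal, norm_rpow_add_one hp]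
  have : v x * conj (v x) = ((‖v x‖ ^ 2 : ℝ) : ℂ) := by
    rw [Complex.mul_conj, Complex.normSq_eq_norm_sq]
  push_cast at this ⊢
  linear_combination ((‖v x‖ ^ (p - 1) : ℝ) : ℂ) * this

/-- Gauge invariance: against a real weight times v the integrand is the real number a|v|^{p+1}.
Used with the weight x². -/
theorem im_inner_powerNL_isMul {p M : ℝ} (hp : 1 ≤ p) {a : ℝ → ℝ} {v q : L2}
    (hv : ∀ᵐ x, ‖v x‖ ≤ M) (hq : IsMul (fun x => (a x : ℂ)) v q) :
    (inner ℂ (powerNL p v) q).im = 0 := by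
  have h1 : inner ℂ (powerNL p v) q =
      ((∫ x, a x * ‖v x‖ ^ (p - 1) * ‖v x‖ ^ 2 : ℝ) : ℂ) := by
    rw [inner_eq_integral, ← integral_complex_ofReal]
    apply integral_congr_ae
    filter_upwards [coeFn_powerNL hp hv, hq] with x h1 h2
    have : v x * conj (v x) = ((‖v x‖ ^ 2 : ℝ) : ℂ) := by
      rw [Complex.mul_conj, Complex.normSq_eq_norm_sq]
    rw [h1, h2, map_mul, Complex.conj_ofReal]
    push_cast at this ⊢
    linear_combination (a x : ℂ) * ((‖v x‖ ^ (p - 1) : ℝ) : ℂ) * this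
  rw [h1, Complex.ofReal_im]

/-- The dilation identity for the power nonlinearity. -/
theorem re_inner_powerNL_dilation {p : ℝ} (hp : 1 < p) {v v1 v2 y m : L2}
    (h1 : IsWeakDeriv 1 v v1) (h2 : IsWeakDeriv 2 v v2) (hy : IsMul (fun x : ℝ => (x : ℂ)) v y)
    (hm : IsMul (fun x : ℝ => (x : ℂ)) v1 m) :
    (p + 1) * (inner ℂ (powerNL p v) m).re = -powerIntegral p v := by
  have hb := ae_norm_le_of_isWeakDeriv h2
  set M := sobolevConst * (‖v‖ + ‖v2‖)
  obtain ⟨V, V1, hV, hV1, hVd, -⟩ := exists_classical h1 h2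
  have hi := integrable_mul_conj (powerNL p v) m
  have hint := integrable_norm_rpow hp hb
  -- The identity is the vanishing of the integral of (x|V|^{p+1})'. The power is differentiated as
  -- (|V|²)^{(p+1)/2}, which is smooth enough even where V vanishes.
  have hder : ∀ x, HasDerivAt (fun x : ℝ => x * ‖V x‖ ^ (p + 1))
      (‖V x‖ ^ (p + 1) + (p + 1) * (x * V1 x * conj (((‖V x‖ ^ (p - 1) : ℝ) : ℂ) * V x)).re) x := by
    intro x
    have e : ∀ (q : ℝ) y, (‖V y‖ ^ 2) ^ (q / 2) = ‖V y‖ ^ q := fun q y => by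
      rw [← Real.rpow_natCast, ← Real.rpow_mul (norm_nonneg _)]
      congr 1
      push_cast
      ring
    have hn := ((hVd x).norm_sq).rpow_const (p := (p + 1) / 2) (Or.inr (by linarith))
    simp_rw [e] at hn
    refine ((hasDerivAt_id' x).fun_mul hn).congr_deriv ?_
    have e2 : (p + 1) / 2 - 1 = (p - 1) / 2 := by ring
    rw [e2, e, map_mul, Complex.conj_ofReal, real_inner_eq_re_inner ℂ, RCLike.inner_apply]
    have e3 : (x : ℂ) * V1 x * (((‖V x‖ ^ (p - 1) : ℝ) : ℂ) * conj (V x)) =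
        ((x * ‖V x‖ ^ (p - 1) : ℝ) : ℂ) * (V1 x * conj (V x)) := by
      push_cast
      ring
    rw [e3, Complex.re_ofReal_mul]
    simp only [RCLike.re_to_complex]
    ring
  have ae1 : (fun x => ‖v x‖ ^ (p + 1) + (p + 1) * (m x * conj (powerNL p v x)).re) =ᵐ[volume]
      fun x => ‖V x‖ ^ (p + 1) +
        (p + 1) * (x * V1 x * conj (((‖V x‖ ^ (p - 1) : ℝ) : ℂ) * V x)).re := by
    filter_upwards [coeFn_powerNL hp.le hb, hm, hV, hV1] with x h1 h2 h3 h4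
    rw [h1, h2, h3, h4]
  have hI : Integrable fun x : ℝ => x * ‖V x‖ ^ (p + 1) := by
    have hi2 := (integrable_mul_conj (powerNL p v) y).re
    refine hi2.congr ?_
    filter_upwards [coeFn_powerNL hp.le hb, hy, hV] with x h1 h2 h3
    have e3 : (x : ℂ) * V x * conj (((‖V x‖ ^ (p - 1) : ℝ) : ℂ) * V x) =
        ((x * ‖V x‖ ^ (p + 1) : ℝ) : ℂ) := by
      rw [map_mul, Complex.conj_ofReal, norm_rpow_add_one hp]
      have : V x * conj (V x) = ((‖V x‖ ^ 2 : ℝ) : ℂ) := by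
        rw [Complex.mul_conj, Complex.normSq_eq_norm_sq]
      push_cast at this ⊢
      linear_combination (x : ℂ) * ((‖V x‖ ^ (p - 1) : ℝ) : ℂ) * this
    rw [h1, h2, h3, e3]
    simp
  have hmI : Integrable fun x => (p + 1) * (m x * conj (powerNL p v x)).re :=
    hi.re.const_mul (p + 1)
  have hI2 : Integrable fun x => ‖v x‖ ^ (p + 1) + (p + 1) * (m x * conj (powerNL p v x)).re :=
    hint.add hmI
  have key := integral_eq_zero_of_hasDerivAt_of_integrable hder (hI2.congr ae1) hI
  rw [← integral_congr_ae ae1, integral_add hint hmI, integral_const_mul] at key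
  have hre : (inner ℂ (powerNL p v) m).re = ∫ x, (m x * conj (powerNL p v x)).re := by
    rw [inner_eq_integral]
    have := integral_re (𝕜 := ℂ) hi
    simpa using this.symm
  rw [hre, powerIntegral]
  linarith

/-! ### Differentiating convex functionals along L² curves. -/

/-- Differentiation of a functional along a curve, when the first-order remainder of the
functional is controlled by the variation of its gradient. -/
theorem hasDerivAt_of_gradient_remainder {g : ℝ → ℝ} {n w : ℝ → L2} {w' : L2} {t : ℝ}
    (hw : HasDerivAt w w' t) (hn : ContinuousAt n t)
    (h : ∀ᶠ s in 𝓝 t, |g s - g t - (inner ℂ (n t) (w s - w t)).re| ≤ ‖n s - n t‖ * ‖w s - w t‖) :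
    HasDerivAt g (inner ℂ (n t) w').re t := by
  rw [hasDerivAt_iff_isLittleO]
  have hO : (fun s => w s - w t) =O[𝓝 t] fun s => s - t := hw.isBigO_sub
  have ho := hasDerivAt_iff_isLittleO.1 hw
  have hn0 : (fun s => n s - n t) =o[𝓝 t] fun _ => (1 : ℝ) := by
    rw [Asymptotics.isLittleO_one_iff]
    exact tendsto_sub_nhds_zero_iff.2 hn
  have h1 : (fun s => g s - g t - (inner ℂ (n t) (w s - w t)).re) =o[𝓝 t] fun s => s - t := by
    have h2 := hn0.norm_norm.mul_isBigO hO.norm_norm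
    have h3 : (fun s => g s - g t - (inner ℂ (n t) (w s - w t)).re) =O[𝓝 t]
        fun s => ‖n s - n t‖ * ‖w s - w t‖ := by
      refine Asymptotics.IsBigO.of_bound 1 ?_
      filter_upwards [h] with s hs
      rw [one_mul, Real.norm_eq_abs, Real.norm_of_nonneg (by positivity)]
      exact hs
    have h4 := h3.trans_isLittleO h2
    simpa using h4
  have h5 : (fun s => (inner ℂ (n t) (w s - w t - (s - t) • w')).re) =o[𝓝 t] fun s => s - t := by
    refine Asymptotics.IsBigO.trans_isLittleO (Asymptotics.IsBigO.of_bound ‖n t‖ ?_) ho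
    filter_upwards with s
    rw [Real.norm_eq_abs]
    exact (Complex.abs_re_le_norm _).trans (norm_inner_le_norm _ _)
  refine (h1.add h5).congr_left fun s => ?_
  rw [inner_sub_right (n t) (w s - w t), Complex.sub_re,
    show (s - t) • w' = ((s - t : ℝ) : ℂ) • w' from (Complex.coe_smul _ _).symm,
    inner_smul_right, Complex.re_ofReal_mul, smul_eq_mul]
  ring

/-- The subgradient inequalities at t and at s squeeze the first-order remainder between 0 and
Re⟨n(s) − n(t), w(s) − w(t)⟩, which is o(s − t). Only continuity of the gradient along the curve is
needed. -/
theorem hasDerivAt_of_convex {g : ℝ → ℝ} {n w : ℝ → L2} {w' : L2} {t : ℝ}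
    (hw : HasDerivAt w w' t) (hn : ContinuousAt n t)
    (h1 : ∀ᶠ s in 𝓝 t, (inner ℂ (n t) (w s - w t)).re ≤ g s - g t)
    (h2 : ∀ᶠ s in 𝓝 t, (inner ℂ (n s) (w t - w s)).re ≤ g t - g s) :
    HasDerivAt g (inner ℂ (n t) w').re t := by
  refine hasDerivAt_of_gradient_remainder hw hn ?_
  filter_upwards [h1, h2] with s hs1 hs2
  have h3 : (inner ℂ (n s - n t) (w s - w t)).re ≤ ‖n s - n t‖ * ‖w s - w t‖ :=
    (Complex.re_le_norm _).trans (norm_inner_le_norm _ _)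
  rw [← neg_sub (w s), inner_neg_right, Complex.neg_re] at hs2
  rw [inner_sub_left, Complex.sub_re] at h3
  rw [abs_of_nonneg (by linarith)]
  linarith

theorem hasDerivAt_powerIntegral {p M : ℝ} (hp : 2 < p) {w : ℝ → L2} {w' : L2} {t : ℝ}
    (hw : HasDerivAt w w' t) (hM : ∀ s, ∀ᵐ x, ‖w s x‖ ≤ M) :
    HasDerivAt (fun s => powerIntegral p (w s))
      ((p + 1) * (inner ℂ (powerNL p (w t)) w').re) t := by
  have hc : ContinuousAt (fun s => powerNL p (w s)) t := by
    rw [ContinuousAt, tendsto_iff_norm_sub_tendsto_zero]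
    have h := (tendsto_iff_norm_sub_tendsto_zero.1 hw.continuousAt).const_mul (p * M ^ (p - 1))
    rw [mul_zero] at h
    exact squeeze_zero (fun _ => norm_nonneg _)
      (fun s => norm_powerNL_sub_le hp (hM s) (hM t)) h
  have e : ∀ a b : L2, (inner ℂ (((p + 1 : ℝ) : ℂ) • a) b).re = (p + 1) * (inner ℂ a b).re :=
    fun a b => by
      rw [inner_smul_left, Complex.conj_ofReal, Complex.re_ofReal_mul]
  rw [← e]
  refine hasDerivAt_of_convex (n := fun s => ((p + 1 : ℝ) : ℂ) • powerNL p (w s)) hw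
    (hc.const_smul ((p + 1 : ℝ) : ℂ))
    (Eventually.of_forall fun s => ?_) (Eventually.of_forall fun s => ?_)
  · rw [e]
    exact powerIntegral_convex (by linarith) (hM t) (hM s)
  · rw [e]
    exact powerIntegral_convex (by linarith) (hM s) (hM t)

/-! ### The averaged nonlinearity -/

theorem ae_norm_propagator_le {f f2 : L2} (hf : IsWeakDeriv 2 f f2) (r : ℝ) :
    ∀ᵐ x, ‖propagator r f x‖ ≤ sobolevConst * (‖f‖ + ‖f2‖) := by
  have := ae_norm_le_of_isWeakDeriv (hf.propagator r)
  rwa [norm_propagator, norm_propagator] at this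

/-- In r the curve solves the free Schrödinger equation and is bounded in H², hence in sup norm,
uniformly. The r-derivative found here is what absorbs the v_xx terms in the averaged identities. -/
theorem hasDerivAt_potential {p : ℝ} (hp : 2 < p) {f f2 : L2} (hf : IsWeakDeriv 2 f f2) (r : ℝ) :
    HasDerivAt (fun r => potential p r f)
      ((p + 1) * (inner ℂ (powerNL p (propagator r f)) (Complex.I • propagator r f2)).re) r :=
  hasDerivAt_powerIntegral hp (hasDerivAt_propagator hf r) (ae_norm_propagator_le hf)

theorem continuous_potential {p : ℝ} (hp : 2 < p) {f f2 : L2} (hf : IsWeakDeriv 2 f f2) :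
    Continuous fun r => potential p r f :=
  continuous_iff_continuousAt.2 fun r => (hasDerivAt_potential hp hf r).continuousAt

theorem potential_nonneg (p r : ℝ) (f : L2) : 0 ≤ potential p r f := powerIntegral_nonneg p _

theorem continuous_powerNL_propagator {p : ℝ} (hp : 2 < p) {f f2 : L2} (hf : IsWeakDeriv 2 f f2) :
    Continuous fun r => powerNL p (propagator r f) := by
  rw [continuous_iff_continuousAt]
  intro r
  rw [ContinuousAt, tendsto_iff_norm_sub_tendsto_zero]
  have h := (tendsto_iff_norm_sub_tendsto_zero.1 ((continuous_propagator f).tendsto r)).const_mul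
    (p * (sobolevConst * (‖f‖ + ‖f2‖)) ^ (p - 1))
  rw [mul_zero] at h
  exact squeeze_zero (fun _ => norm_nonneg _) (fun s => norm_powerNL_sub_le hp
    (ae_norm_propagator_le hf s) (ae_norm_propagator_le hf r)) h

theorem continuous_avgNL_integrand {p : ℝ} (hp : 2 < p) {f f2 : L2} (hf : IsWeakDeriv 2 f f2) :
    Continuous fun r => propagator (-r) (powerNL p (propagator r f)) :=
  continuous_propagator_comp continuous_neg (continuous_powerNL_propagator hp hf)

theorem continuous_inner_powerNL {p : ℝ} (hp : 2 < p) {f f2 : L2} (hf : IsWeakDeriv 2 f f2)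
    (g : L2) : Continuous fun r => inner ℂ (powerNL p (propagator r f)) (propagator r g) :=
  (continuous_powerNL_propagator hp hf).inner (continuous_propagator g)

theorem inner_avgNL {p : ℝ} (hp : 2 < p) {f f2 : L2} (hf : IsWeakDeriv 2 f f2) (g : L2) :
    inner ℂ (avgNL p f) g =
      ∫ r in (0 : ℝ)..1, inner ℂ (powerNL p (propagator r f)) (propagator r g) := by
  have h1 : inner ℂ g (avgNL p f) =
      ∫ r in (0 : ℝ)..1, inner ℂ (propagator r g) (powerNL p (propagator r f)) := by
    have := (innerSL ℂ g).intervalIntegral_comp_comm (μ := volume)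
      ((continuous_avgNL_integrand hp hf).intervalIntegrable 0 1)
    rw [avgNL, ← innerSL_apply_apply, ← this]
    congr 1
    ext r
    rw [innerSL_apply_apply, inner_propagator_neg]
  rw [← inner_conj_symm, h1, intervalIntegral.integral_of_le zero_le_one,
    intervalIntegral.integral_of_le zero_le_one, ← integral_conj]
  simp_rw [inner_conj_symm]

theorem re_inner_avgNL {p : ℝ} (hp : 2 < p) {f f2 : L2} (hf : IsWeakDeriv 2 f f2) (g : L2) :
    (inner ℂ (avgNL p f) g).re =
      ∫ r in (0 : ℝ)..1, (inner ℂ (powerNL p (propagator r f)) (propagator r g)).re := by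
  rw [inner_avgNL hp hf]
  exact (Complex.reCLM.intervalIntegral_comp_comm
    ((continuous_inner_powerNL hp hf g).intervalIntegrable 0 1)).symm

theorem im_inner_avgNL {p : ℝ} (hp : 2 < p) {f f2 : L2} (hf : IsWeakDeriv 2 f f2) (g : L2) :
    (inner ℂ (avgNL p f) g).im =
      ∫ r in (0 : ℝ)..1, (inner ℂ (powerNL p (propagator r f)) (propagator r g)).im := by
  rw [inner_avgNL hp hf]
  exact (Complex.imCLM.intervalIntegral_comp_comm
    ((continuous_inner_powerNL hp hf g).intervalIntegrable 0 1)).symm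

/-- `∫₀¹ ‖e^{ir∂ₓ²} f‖_{L^{p+1}}^{p+1} dr`. -/
def avgPotential (p : ℝ) (f : L2) : ℝ := ∫ r in (0 : ℝ)..1, potential p r f

theorem avgPotential_convex {p : ℝ} (hp : 2 < p) {a a2 b b2 : L2} (ha : IsWeakDeriv 2 a a2)
    (hb : IsWeakDeriv 2 b b2) :
    (p + 1) * (inner ℂ (avgNL p a) (b - a)).re ≤ avgPotential p b - avgPotential p a := by
  rw [re_inner_avgNL hp ha, avgPotential, avgPotential,
    ← intervalIntegral.integral_sub ((continuous_potential hp hb).intervalIntegrable 0 1)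
      ((continuous_potential hp ha).intervalIntegrable 0 1), ← intervalIntegral.integral_const_mul]
  refine intervalIntegral.integral_mono_on zero_le_one
    (((Complex.continuous_re.comp (continuous_inner_powerNL hp ha (b - a))).const_mul
      (p + 1)).intervalIntegrable 0 1)
    (((continuous_potential hp hb).sub (continuous_potential hp ha)).intervalIntegrable 0 1)
    fun r _ => ?_
  rw [propagator_sub]
  have h1 := ae_norm_propagator_le ha r
  have h2 := ae_norm_propagator_le hb r
  refine powerIntegral_convex
    (M := max (sobolevConst * (‖a‖ + ‖a2‖)) (sobolevConst * (‖b‖ + ‖b2‖))) (by linarith) ?_ ?_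
  · filter_upwards [h1] with x hx using hx.trans (le_max_left _ _)
  · filter_upwards [h2] with x hx using hx.trans (le_max_right _ _)

theorem norm_avgNL_sub_le {p M : ℝ} (hp : 2 < p) {a a2 b b2 : L2} (ha : IsWeakDeriv 2 a a2)
    (hb : IsWeakDeriv 2 b b2) (haM : sobolevConst * (‖a‖ + ‖a2‖) ≤ M)
    (hbM : sobolevConst * (‖b‖ + ‖b2‖) ≤ M) :
    ‖avgNL p a - avgNL p b‖ ≤ p * M ^ (p - 1) * ‖a - b‖ := by
  rw [avgNL, avgNL, ← intervalIntegral.integral_sub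
    ((continuous_avgNL_integrand hp ha).intervalIntegrable 0 1)
    ((continuous_avgNL_integrand hp hb).intervalIntegrable 0 1)]
  have := intervalIntegral.norm_integral_le_of_norm_le_const (a := 0) (b := 1)
    (C := p * M ^ (p - 1) * ‖a - b‖)
    (f := fun r => propagator (-r) (powerNL p (propagator r a)) -
      propagator (-r) (powerNL p (propagator r b))) (fun r _ => by
    rw [← propagator_sub, norm_propagator, ← norm_propagator r (a - b), propagator_sub]
    refine norm_powerNL_sub_le hp ?_ ?_
    · filter_upwards [ae_norm_propagator_le ha r] with x hx using hx.trans haM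
    · filter_upwards [ae_norm_propagator_le hb r] with x hx using hx.trans hbM)
  simpa using this

theorem re_inner_avgNL_self {p : ℝ} (hp : 2 < p) {f f2 : L2} (hf : IsWeakDeriv 2 f f2) :
    (inner ℂ (avgNL p f) f).re = avgPotential p f := by
  rw [re_inner_avgNL hp hf, avgPotential]
  congr 1
  ext r
  rw [inner_powerNL_self (by linarith) (ae_norm_propagator_le hf r), Complex.ofReal_re]
  rfl

theorem continuous_deriv_potential {p : ℝ} (hp : 2 < p) {f f2 : L2} (hf : IsWeakDeriv 2 f f2) :
    Continuous fun r => (p + 1) *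
      (inner ℂ (powerNL p (propagator r f)) (Complex.I • propagator r f2)).re := by
  have h := (continuous_powerNL_propagator hp hf).inner (𝕜 := ℂ)
    ((continuous_propagator f2).const_smul Complex.I)
  exact continuous_const.mul (Complex.continuous_re.comp h)

/-- Commutation gives U(r)(x f') = x v' + 2ir v'' for v = U(r)f. The first term is handled by the
dilation identity, and the second is 2r P'(r). -/
theorem re_inner_powerNL_propagator_dilation {p : ℝ} (hp : 2 < p) {f f1 f2 y m : L2}
    (h1 : IsWeakDeriv 1 f f1) (h2 : IsWeakDeriv 2 f f2) (hy : IsMul (fun x : ℝ => (x : ℂ)) f y)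
    (hm : IsMul (fun x : ℝ => (x : ℂ)) f1 m) (r : ℝ) :
    (p + 1) * (inner ℂ (powerNL p (propagator r f)) (propagator r m)).re =
      -potential p r f + 2 * r * ((p + 1) *
        (inner ℂ (powerNL p (propagator r f)) (Complex.I • propagator r f2)).re) := by
  have h := re_inner_powerNL_dilation (p := p) (by linarith) (h1.propagator r) (h2.propagator r)
    (hy.propagator h1 r) (hm.propagator (h1.of_add h2) r)
  rw [inner_sub_right, Complex.sub_re, mul_smul, inner_smul_right] at h
  have e : (2 * (r : ℂ)) = ((2 * r : ℝ) : ℂ) := by push_cast; rfl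
  rw [e, Complex.re_ofReal_mul] at h
  have e2 : potential p r f = powerIntegral p (propagator r f) := rfl
  rw [e2]
  linarith

/-- Commuting x twice gives U(r)(x²f) = x²v + 2ir v + 4ir U(r)(x f') + 4r² v''. Pairing with
|v|^{p-1}v, the first term has zero imaginary part, the third is given by the previous lemma, and
(p+1) Im⟨|v|^{p-1}v, v''⟩ = −P'(r). -/
theorem im_inner_powerNL_propagator_sq {p : ℝ} (hp : 2 < p) {f f1 f2 y m h : L2}
    (h1 : IsWeakDeriv 1 f f1) (h2 : IsWeakDeriv 2 f f2) (hy : IsMul (fun x : ℝ => (x : ℂ)) f y)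
    (hm : IsMul (fun x : ℝ => (x : ℂ)) f1 m) (hh : IsMul (fun x : ℝ => (x : ℂ)) y h) (r : ℝ) :
    (p + 1) * (inner ℂ (powerNL p (propagator r f)) (propagator r h)).im =
      (2 * (p + 1) - 4) * (r * potential p r f) + 4 * r ^ 2 * ((p + 1) *
        (inner ℂ (powerNL p (propagator r f)) (Complex.I • propagator r f2)).re) := by
  have hdil := re_inner_powerNL_propagator_dilation hp h1 h2 hy hm r
  have hb := ae_norm_propagator_le h2 r
  have hy1 : IsWeakDeriv 1 y (f + m) :=
    isWeakDeriv_mul (a := fun x : ℝ => (x : ℂ)) (a' := fun _ => 1) (by fun_prop) (by fun_prop)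
      (fun x => Complex.ofRealCLM.hasDerivAt) h1 hy (isMul_one f) hm
  have hxx := (hy.propagator h1 r).mul ((hh.propagator hy1 r).sub
    ((hm.propagator (h1.of_add h2) r).smul (2 * r * Complex.I)))
  have hq : IsMul (fun x : ℝ => ((x * x : ℝ) : ℂ)) (propagator r f)
      (propagator r h - (2 * r * Complex.I) • propagator r (f + m) -
        (2 * r * Complex.I) • (propagator r m - (2 * r * Complex.I) • propagator r f2)) := by
    push_cast
    exact hxx
  have him := im_inner_powerNL_isMul (p := p) (by linarith) hb hq
  have hself := inner_powerNL_self (p := p) (by linarith) hb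
  have e2 : powerIntegral p (propagator r f) = potential p r f := rfl
  rw [e2] at hself
  rw [propagator_add] at him
  simp only [inner_sub_right, inner_smul_right, inner_add_right, hself] at him hdil ⊢
  set A := (inner ℂ (powerNL p (propagator r f)) (propagator r m) : ℂ)
  set B := (inner ℂ (powerNL p (propagator r f)) (propagator r f2) : ℂ)
  set H := (inner ℂ (powerNL p (propagator r f)) (propagator r h) : ℂ)
  simp only [Complex.sub_im, Complex.mul_im, Complex.mul_re, Complex.add_im, Complex.add_re,
    Complex.sub_re, Complex.ofReal_re, Complex.ofReal_im, Complex.I_re, Complex.I_im,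
    Complex.re_ofNat, Complex.im_ofNat] at him hdil ⊢
  ring_nf at him hdil ⊢
  linear_combination (p + 1) * him + 4 * r * hdil

theorem re_inner_avgNL_dilation {p : ℝ} (hp : 2 < p) {f f1 f2 y m : L2}
    (h1 : IsWeakDeriv 1 f f1) (h2 : IsWeakDeriv 2 f f2) (hy : IsMul (fun x : ℝ => (x : ℂ)) f y)
    (hm : IsMul (fun x : ℝ => (x : ℂ)) f1 m) :
    (p + 1) * (inner ℂ (avgNL p f) m).re = 2 * potential p 1 f - 3 * avgPotential p f := by
  have hc := continuous_potential hp h2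
  have hc' := continuous_deriv_potential hp h2
  rw [re_inner_avgNL hp h2, ← intervalIntegral.integral_const_mul]
  -- The integrand −P + 2rP' equals (2rP)' − 3P.
  have hd : ∀ r : ℝ, HasDerivAt (fun r => 2 * r * potential p r f) (2 * potential p r f +
      2 * r * ((p + 1) * (inner ℂ (powerNL p (propagator r f)) (Complex.I • propagator r f2)).re))
      r := fun r => by
    have := ((hasDerivAt_id' r).const_mul 2).fun_mul (hasDerivAt_potential hp h2 r)
    simpa using this
  have hI := intervalIntegral.integral_eq_sub_of_hasDerivAt (a := 0) (b := 1) (fun r _ => hd r)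
    (Continuous.intervalIntegrable (by fun_prop) 0 1)
  have e : ∀ r, (p + 1) * (inner ℂ (powerNL p (propagator r f)) (propagator r m)).re =
      (2 * potential p r f + 2 * r * ((p + 1) *
        (inner ℂ (powerNL p (propagator r f)) (Complex.I • propagator r f2)).re)) -
      3 * potential p r f := fun r => by
    rw [re_inner_powerNL_propagator_dilation hp h1 h2 hy hm]
    ring
  simp_rw [e]
  rw [intervalIntegral.integral_sub (Continuous.intervalIntegrable (by fun_prop) 0 1)
    (Continuous.intervalIntegrable (by fun_prop) 0 1), hI, intervalIntegral.integral_const_mul]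
  simp [avgPotential]

/-- The integrand is (4r²P)' + 2(p−5) rP, so the integral is 4P(1) + 2(p−5)∫₀¹ rP. This sign is what
makes V' ≥ W. -/
theorem im_inner_avgNL_sq_nonneg {p : ℝ} (hp : 2 < p) (hp5 : 5 ≤ p) {f f1 f2 y m h : L2}
    (h1 : IsWeakDeriv 1 f f1) (h2 : IsWeakDeriv 2 f f2) (hy : IsMul (fun x : ℝ => (x : ℂ)) f y)
    (hm : IsMul (fun x : ℝ => (x : ℂ)) f1 m) (hh : IsMul (fun x : ℝ => (x : ℂ)) y h) :
    0 ≤ (inner ℂ (avgNL p f) h).im := by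
  have hc := continuous_potential hp h2
  have hc' := continuous_deriv_potential hp h2
  suffices 0 ≤ (p + 1) * (inner ℂ (avgNL p f) h).im from
    nonneg_of_mul_nonneg_right this (by linarith)
  rw [im_inner_avgNL hp h2, ← intervalIntegral.integral_const_mul]
  have hd : ∀ r : ℝ, HasDerivAt (fun r => 4 * r ^ 2 * potential p r f)
      (8 * r * potential p r f + 4 * r ^ 2 * ((p + 1) *
        (inner ℂ (powerNL p (propagator r f)) (Complex.I • propagator r f2)).re)) r := fun r => by
    refine ((((hasDerivAt_id' r).fun_pow 2).const_mul 4).fun_mul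
      (hasDerivAt_potential hp h2 r)).congr_deriv ?_
    simp only [Nat.cast_ofNat, Nat.add_one_sub_one, pow_one]
    ring
  have hI := intervalIntegral.integral_eq_sub_of_hasDerivAt (a := 0) (b := 1) (fun r _ => hd r)
    (Continuous.intervalIntegrable (by fun_prop) 0 1)
  have e : ∀ r, (p + 1) * (inner ℂ (powerNL p (propagator r f)) (propagator r h)).im =
      (8 * r * potential p r f + 4 * r ^ 2 * ((p + 1) *
        (inner ℂ (powerNL p (propagator r f)) (Complex.I • propagator r f2)).re)) +
      (2 * (p + 1) - 12) * (r * potential p r f) := fun r => by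
    rw [im_inner_powerNL_propagator_sq hp h1 h2 hy hm hh]
    ring
  simp_rw [e]
  rw [intervalIntegral.integral_add (Continuous.intervalIntegrable (by fun_prop) 0 1)
    (Continuous.intervalIntegrable (by fun_prop) 0 1), hI, intervalIntegral.integral_const_mul]
  have hpos : 0 ≤ ∫ r in (0 : ℝ)..1, r * potential p r f :=
    intervalIntegral.integral_nonneg zero_le_one fun r hr =>
      mul_nonneg hr.1 (potential_nonneg p r f)
  have := potential_nonneg p 1 f
  have := mul_nonneg (by linarith : 0 ≤ 2 * (p + 1) - 12) hpos
  norm_num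
  linarith

/-! ### Quadratic functionals on the weighted Sobolev space -/

theorem IsMul.integral_eq_inner_left {a : ℝ → ℝ} {h k : L2} (hk : IsMul (fun x => (a x : ℂ)) h k)
    (f : L2) : ∫ x, (a x : ℂ) * (f x * conj (h x)) = inner ℂ k f := by
  rw [inner_eq_integral]
  apply integral_congr_ae
  filter_upwards [hk] with x hx
  rw [hx, map_mul, Complex.conj_ofReal]
  ring

theorem IsMul.integrable_mul_conj_left {a : ℝ → ℝ} {h k : L2}
    (hk : IsMul (fun x => (a x : ℂ)) h k) (f : L2) :
    Integrable fun x => (a x : ℂ) * (f x * conj (h x)) := by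
  refine (DMNLS.integrable_mul_conj k f).congr ?_
  filter_upwards [hk] with x hx
  rw [hx, map_mul, Complex.conj_ofReal]
  ring

theorem MemHkk.isMul_one {f : L2} (hf : MemHkk 3 f) :
    IsMul (fun x : ℝ => (x : ℂ)) f (weightMul 1 f) := by
  simpa using hf.isMul (j := 1) (by norm_num)

theorem MemHkk.isMul_weightMul {f : L2} (hf : MemHkk 3 f) :
    IsMul (fun x : ℝ => (x : ℂ)) (weightMul 1 f) (weightMul 2 f) := by
  refine hf.isMul_one.of_mul ?_
  have := hf.isMul (j := 2) (by norm_num)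
  simpa [sq] using this

theorem MemHkk.inner_weightMul_deriv {f g : L2} (hf : MemHkk 3 f) (hg : MemHkk 3 g) :
    inner ℂ f g + inner ℂ f (weightMul 1 (weakDeriv 1 g)) +
      inner ℂ (weightMul 1 (weakDeriv 1 f)) g = 0 := by
  have h := inner_weight_parts (a := fun x => x) (a' := fun _ => 1) hasDerivAt_id'
    (hf.isWeakDeriv (by norm_num)) (hf.isWeakDeriv (by norm_num))
    (hg.isWeakDeriv (by norm_num)) (hg.isWeakDeriv (by norm_num))
    (hg.isMul_one.integrable_mul_conj f)
    (by simpa using integrable_mul_conj f g)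
    (hg.isMul_deriv.integrable_mul_conj f)
    (hf.isMul_deriv.integrable_mul_conj_left g)
  rw [hg.isMul_deriv.integral_eq_inner, hf.isMul_deriv.integral_eq_inner_left] at h
  simp only [Complex.ofReal_one, one_mul] at h
  rwa [← inner_eq_integral] at h

theorem MemHkk.re_inner_weightMul_deriv {f : L2} (hf : MemHkk 3 f) :
    2 * (inner ℂ (weightMul 1 (weakDeriv 1 f)) (weakDeriv 2 f)).re = -‖weakDeriv 1 f‖ ^ 2 := by
  have h1 := hf.isWeakDeriv (j := 1) (by norm_num)
  have h2 : IsWeakDeriv 1 (weakDeriv 1 f) (weakDeriv 2 f) :=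
    h1.of_add (hf.isWeakDeriv (j := 2) (by norm_num))
  have h3 : IsWeakDeriv 2 (weakDeriv 1 f) (weakDeriv 3 f) :=
    h1.of_add (hf.isWeakDeriv (j := 3) le_rfl)
  have h := inner_weight_parts (a := fun x => x) (a' := fun _ => 1) hasDerivAt_id' h2 h3 h2 h3
    (hf.isMul_deriv.integrable_mul_conj _) (by simpa using integrable_mul_conj _ _)
    (hf.isMul_deriv.integrable_mul_conj_left _) (hf.isMul_deriv.integrable_mul_conj _)
  rw [hf.isMul_deriv.integral_eq_inner, hf.isMul_deriv.integral_eq_inner_left] at h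
  simp only [Complex.ofReal_one, one_mul] at h
  rw [← inner_eq_integral, inner_self_eq_norm_sq_to_K,
    ← inner_conj_symm (weakDeriv 2 f)] at h
  have := congrArg Complex.re h
  simp only [Complex.add_re, Complex.conj_re, Complex.zero_re, Complex.coe_algebraMap,
    ← Complex.ofReal_pow, Complex.ofReal_re] at this
  linarith

/-- One integration by parts with weight x²; the term ‖x f'‖² is real and drops out. This identifies
the free part of V' with the virial. -/
theorem MemHkk.im_inner_weightMul_sq {f : L2} (hf : MemHkk 3 f) :
    (inner ℂ (weightMul 2 f) (weakDeriv 2 f)).im =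
      -2 * (inner ℂ f (weightMul 1 (weakDeriv 1 f))).im := by
  have h1 := hf.isWeakDeriv (j := 1) (by norm_num)
  have h2 := hf.isWeakDeriv (j := 2) (by norm_num)
  have h2' : IsWeakDeriv 1 (weakDeriv 1 f) (weakDeriv 2 f) := h1.of_add h2
  have h3 : IsWeakDeriv 2 (weakDeriv 1 f) (weakDeriv 3 f) :=
    h1.of_add (hf.isWeakDeriv (j := 3) le_rfl)
  have hw := hf.isMul (j := 2) (by norm_num)
  have hd2 := hf.isMul_deriv.const_mul 2
  have e3 : (fun x : ℝ => ((x ^ 2 : ℝ) : ℂ) * (weakDeriv 1 f x * conj (weakDeriv 1 f x)))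
      =ᵐ[volume] fun x => weightMul 1 (weakDeriv 1 f) x * conj (weightMul 1 (weakDeriv 1 f) x) := by
    filter_upwards [hf.isMul_deriv] with x hx
    rw [hx, map_mul, Complex.conj_ofReal]
    push_cast
    ring
  have h := inner_weight_parts (a := fun x => x ^ 2) (a' := fun x => 2 * x)
    (fun x => by simpa using hasDerivAt_pow 2 x) h1 h2 h2' h3
    (hw.integrable_mul_conj_left _) (by simpa using hd2.integrable_mul_conj f)
    (hw.integrable_mul_conj_left _) ((integrable_mul_conj _ _).congr e3.symm)
  rw [integral_congr_ae e3, ← inner_eq_integral, inner_self_eq_norm_sq_to_K,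
    hw.integral_eq_inner_left] at h
  simp only [Complex.ofReal_mul, Complex.ofReal_ofNat] at h
  rw [hd2.integral_eq_inner, inner_smul_right] at h
  have := congrArg Complex.im h
  simp only [Complex.add_im, Complex.zero_im, Complex.coe_algebraMap,
    ← Complex.ofReal_pow, Complex.ofReal_im, Complex.mul_im, Complex.re_ofNat,
    Complex.im_ofNat] at this
  linarith

theorem MemHkk.inner_weakDeriv_two {f g : L2} (hf : MemHkk 3 f) (hg : MemHkk 3 g) :
    inner ℂ (weakDeriv 2 f) g = -inner ℂ (weakDeriv 1 f) (weakDeriv 1 g) := by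
  have h1 := hf.isWeakDeriv (j := 1) (by norm_num)
  exact IsWeakDeriv.inner_left (h1.of_add (hf.isWeakDeriv (j := 2) (by norm_num)))
    (hg.isWeakDeriv (j := 1) (by norm_num))

theorem MemHkk.inner_weakDeriv_two_symm {f g : L2} (hf : MemHkk 3 f) (hg : MemHkk 3 g) :
    inner ℂ (weakDeriv 2 f) g = inner ℂ f (weakDeriv 2 g) := by
  have h1 := hg.isWeakDeriv (j := 1) (by norm_num)
  rw [hf.inner_weakDeriv_two hg, IsWeakDeriv.inner_left (hf.isWeakDeriv (j := 1) (by norm_num))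
    (h1.of_add (hg.isWeakDeriv (j := 2) (by norm_num))), neg_neg]

theorem MemHkk.norm_sq_weakDeriv {f : L2} (hf : MemHkk 3 f) :
    ‖weakDeriv 1 f‖ ^ 2 = -(inner ℂ (weakDeriv 2 f) f).re := by
  rw [hf.inner_weakDeriv_two hf, inner_self_eq_norm_sq_to_K]
  simp [← Complex.ofReal_pow]

theorem MemHkk.integrable_variance {f : L2} (hf : MemHkk 3 f) :
    Integrable fun x : ℝ => x ^ 2 * ‖f x‖ ^ 2 := by
  refine (integrable_norm_sq (weightMul 1 f)).congr ?_
  filter_upwards [hf.isMul_one] with x hx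
  rw [hx, norm_mul, mul_pow, Complex.norm_real, Real.norm_eq_abs, sq_abs]

theorem MemHkk.variance_eq {f : L2} (hf : MemHkk 3 f) :
    variance f = (inner ℂ (weightMul 2 f) f).re := by
  have h1 : inner ℂ (weightMul 2 f) f = ((∫ x : ℝ, x ^ 2 * ‖f x‖ ^ 2 : ℝ) : ℂ) := by
    rw [inner_eq_integral, ← integral_complex_ofReal]
    apply integral_congr_ae
    filter_upwards [hf.isMul (j := 2) (by norm_num)] with x hx
    have : f x * conj (f x) = ((‖f x‖ ^ 2 : ℝ) : ℂ) := by
      rw [Complex.mul_conj, Complex.normSq_eq_norm_sq]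
    rw [hx, map_mul, Complex.conj_ofReal]
    push_cast at this ⊢
    linear_combination (x : ℂ) ^ 2 * this
  rw [h1, Complex.ofReal_re, variance]

theorem MemHkk.integrable_virial {f : L2} (hf : MemHkk 3 f) :
    Integrable fun x : ℝ => (x : ℂ) * weakDeriv 1 f x * conj (f x) := by
  simpa only [mul_assoc] using hf.isMul_deriv.integrable_mul_conj f

theorem MemHkk.virial_eq_im {f : L2} (hf : MemHkk 3 f) :
    virial f = 4 * (inner ℂ f (weightMul 1 (weakDeriv 1 f))).im := by
  rw [virial, ← hf.isMul_deriv.integral_eq_inner]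
  simp only [mul_assoc]

/-- The generator `-2i(2x∂ₓ + 1)` of dilations. -/
def dilationGen (f : L2) : L2 :=
  (-(2 * Complex.I)) • ((2 : ℂ) • weightMul 1 (weakDeriv 1 f) + f)

theorem inner_dilationGen (f g : L2) : inner ℂ (dilationGen f) g =
    2 * Complex.I * (2 * inner ℂ (weightMul 1 (weakDeriv 1 f)) g + inner ℂ f g) := by
  rw [dilationGen, inner_smul_left, inner_add_left, inner_smul_left]
  simp [Complex.conj_ofNat]

/-- The formal adjoint of x∂ₓ is −x∂ₓ − 1, so 2x∂ₓ + 1 is antisymmetric and the factor i makes it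
symmetric. The virial thereby becomes a symmetric quadratic form. -/
theorem MemHkk.inner_dilationGen_symm {f g : L2} (hf : MemHkk 3 f) (hg : MemHkk 3 g) :
    inner ℂ (dilationGen f) g = inner ℂ f (dilationGen g) := by
  rw [inner_dilationGen, dilationGen, inner_smul_right, inner_add_right, inner_smul_right]
  linear_combination (4 * Complex.I) * hf.inner_weightMul_deriv hg

theorem MemHkk.virial_eq {f : L2} (hf : MemHkk 3 f) :
    virial f = (inner ℂ (dilationGen f) f).re := by
  rw [hf.inner_dilationGen_symm hf, dilationGen, inner_smul_right, inner_add_right,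
    inner_smul_right, inner_self_eq_norm_sq_to_K, hf.virial_eq_im]
  simp [← Complex.ofReal_pow]
  ring

/-- Here n stands for Bw with B symmetric and possibly unbounded. Symmetry makes the remainder
exactly Re⟨n(s) − n(t), w(s) − w(t)⟩, so B is never applied to w'. -/
theorem hasDerivAt_quadratic {n w : ℝ → L2} {w' : L2} {t : ℝ} (hw : HasDerivAt w w' t)
    (hn : ContinuousAt n t) (hsymm : ∀ᶠ s in 𝓝 t, inner ℂ (n s) (w t) = inner ℂ (w s) (n t)) :
    HasDerivAt (fun s => (inner ℂ (n s) (w s)).re) (2 * (inner ℂ (n t) w').re) t := by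
  have e : ∀ a b : L2, (inner ℂ ((2 : ℂ) • a) b).re = 2 * (inner ℂ a b).re := fun a b => by
    rw [inner_smul_left]
    simp
  rw [← e]
  refine hasDerivAt_of_gradient_remainder (n := fun s => (2 : ℂ) • n s) hw
    (hn.const_smul (2 : ℂ)) ?_
  filter_upwards [hsymm] with s hs
  have h1 : (inner ℂ (n s) (w s)).re - (inner ℂ (n t) (w t)).re -
      (inner ℂ ((2 : ℂ) • n t) (w s - w t)).re = (inner ℂ (n s - n t) (w s - w t)).re := by
    rw [e]
    simp only [inner_sub_left, inner_sub_right, Complex.sub_re, hs]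
    rw [← inner_conj_symm (w s) (n t), Complex.conj_re]
    ring
  rw [h1, ← smul_sub, norm_smul]
  refine ((Complex.abs_re_le_norm _).trans (norm_inner_le_norm _ _)).trans ?_
  refine mul_le_mul_of_nonneg_right ?_ (norm_nonneg _)
  rw [Complex.norm_ofNat]
  linarith [norm_nonneg (n s - n t)]

/-! ### The time interval and continuity along a solution -/

theorem isOpen_timeInterval (Tmin Tmax : EReal) : IsOpen (timeInterval Tmin Tmax) :=
  (isOpen_Ioi.preimage continuous_coe_real_ereal).inter
    (isOpen_Iio.preimage continuous_coe_real_ereal)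

theorem ordConnected_timeInterval (Tmin Tmax : EReal) : (timeInterval Tmin Tmax).OrdConnected :=
  ⟨fun _ hx _ hy _ hz => ⟨hx.1.trans_le (EReal.coe_le_coe_iff.2 hz.1),
    (EReal.coe_le_coe_iff.2 hz.2).trans_lt hy.2⟩⟩

theorem zero_mem_timeInterval {Tmin Tmax : EReal} (hTmin : 0 < Tmin) (hTmax : 0 < Tmax) :
    (0 : ℝ) ∈ timeInterval Tmin Tmax :=
  ⟨by simpa using EReal.neg_lt_neg_iff.2 hTmin, by simpa using hTmax⟩

section Solution

variable {p : ℝ} {Tmin Tmax : EReal} {u₀ : L2} {u : ℝ → L2}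

theorem IsSolution.eventually_mem (hu : IsSolution p Tmin Tmax u₀ u) {t : ℝ}
    (ht : t ∈ timeInterval Tmin Tmax) : ∀ᶠ s in 𝓝 t, MemHkk 3 (u s) := by
  filter_upwards [(isOpen_timeInterval Tmin Tmax).mem_nhds ht] with s hs using hu.mem s hs

theorem IsSolution.continuousAt_of_bounded (hu : IsSolution p Tmin Tmax u₀ u) {A : L2 → L2} {C : ℝ}
    (hsub : ∀ {f g}, MemHkk 3 f → MemHkk 3 g → A (f - g) = A f - A g)
    (hA : ∀ {f}, MemHkk 3 f → ‖A f‖ ≤ C * hkkNorm 3 f) {t : ℝ}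
    (ht : t ∈ timeInterval Tmin Tmax) : ContinuousAt (fun s => A (u s)) t := by
  rw [ContinuousAt, tendsto_iff_norm_sub_tendsto_zero]
  have h := (hu.continuous t ht).const_mul C
  rw [(isOpen_timeInterval Tmin Tmax).nhdsWithin_eq ht, mul_zero] at h
  refine squeeze_zero' (Eventually.of_forall fun _ => norm_nonneg _) ?_ h
  filter_upwards [hu.eventually_mem ht] with s hs
  rw [← hsub hs (hu.mem t ht)]
  exact hA (hs.sub (hu.mem t ht))

theorem IsSolution.continuousAt_weakDeriv_two (hu : IsSolution p Tmin Tmax u₀ u) {t : ℝ}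
    (ht : t ∈ timeInterval Tmin Tmax) : ContinuousAt (fun s => weakDeriv 2 (u s)) t :=
  hu.continuousAt_of_bounded (C := 2) (fun hf hg => hf.weakDeriv_sub (by norm_num) hg)
    (fun hf => (hf.isWeakDeriv_norm_le (by norm_num)).2) ht

theorem IsSolution.continuousAt_weightMul_two (hu : IsSolution p Tmin Tmax u₀ u) {t : ℝ}
    (ht : t ∈ timeInterval Tmin Tmax) : ContinuousAt (fun s => weightMul 2 (u s)) t :=
  hu.continuousAt_of_bounded (C := 2) (fun hf hg => hf.weightMul_sub (by norm_num) hg)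
    (fun hf => (hf.isMul_norm_le (by norm_num)).2) ht

theorem IsSolution.continuousAt (hu : IsSolution p Tmin Tmax u₀ u) {t : ℝ}
    (ht : t ∈ timeInterval Tmin Tmax) : ContinuousAt u t :=
  (hu.equation t ht).choose_spec.1.continuousAt

theorem IsSolution.continuousAt_dilationGen (hu : IsSolution p Tmin Tmax u₀ u) {t : ℝ}
    (ht : t ∈ timeInterval Tmin Tmax) : ContinuousAt (fun s => dilationGen (u s)) t := by
  have h : ContinuousAt (fun s => weightMul 1 (weakDeriv 1 (u s))) t :=
    hu.continuousAt_of_bounded (C := 6) (A := fun f => weightMul 1 (weakDeriv 1 f))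
      (fun hf hg => hf.weightMul_weakDeriv_sub hg) (fun hf => hf.isMul_deriv_norm_le.2) ht
  exact ((h.const_smul (2 : ℂ)).add (hu.continuousAt ht)).const_smul (-(2 * Complex.I))

/-- The nonlinearity is Lipschitz in L² on sets bounded in H², and the H² norm of u stays bounded
near t by continuity. -/
theorem IsSolution.continuousAt_avgNL (hp : 2 < p) (hu : IsSolution p Tmin Tmax u₀ u) {t : ℝ}
    (ht : t ∈ timeInterval Tmin Tmax) : ContinuousAt (fun s => avgNL p (u s)) t := by
  set b : ℝ → ℝ := fun s => sobolevConst * (‖u s‖ + ‖weakDeriv 2 (u s)‖) with hb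
  have hbc : ContinuousAt b t := continuousAt_const.mul
    ((hu.continuousAt ht).norm.add (hu.continuousAt_weakDeriv_two ht).norm)
  have hev : ∀ᶠ s in 𝓝 t, b s ≤ b t + 1 := by
    filter_upwards [hbc.eventually (gt_mem_nhds (lt_add_one (b t)))] with s hs using hs.le
  rw [ContinuousAt, tendsto_iff_norm_sub_tendsto_zero]
  have h := (tendsto_iff_norm_sub_tendsto_zero.1 (hu.continuousAt ht)).const_mul
    (p * (b t + 1) ^ (p - 1))
  rw [mul_zero] at h
  refine squeeze_zero' (Eventually.of_forall fun _ => norm_nonneg _) ?_ h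
  filter_upwards [hev, hu.eventually_mem ht] with s hs hm
  exact norm_avgNL_sub_le hp (hm.isWeakDeriv (by norm_num))
    ((hu.mem t ht).isWeakDeriv (by norm_num)) hs (by linarith)

/-! ### Derivatives along a solution -/

theorem IsSolution.hasDerivAt (hu : IsSolution p Tmin Tmax u₀ u) {t : ℝ}
    (ht : t ∈ timeInterval Tmin Tmax) :
    HasDerivAt u (Complex.I • (weakDeriv 2 (u t) + avgNL p (u t))) t := by
  obtain ⟨ut, h1, h2⟩ := hu.equation t ht
  convert h1 using 1
  have h3 : weakDeriv 2 (u t) + avgNL p (u t) = -(Complex.I • ut) := by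
    rw [add_assoc] at h2
    exact (neg_eq_of_add_eq_zero_right h2).symm
  rw [h3, smul_neg, smul_smul, Complex.I_mul_I, neg_one_smul, neg_neg]

theorem IsSolution.hasDerivAt_avgPotential (hp : 2 < p) (hu : IsSolution p Tmin Tmax u₀ u) {t : ℝ}
    (ht : t ∈ timeInterval Tmin Tmax) : HasDerivAt (fun s => avgPotential p (u s))
      ((p + 1) * (inner ℂ (avgNL p (u t))
        (Complex.I • (weakDeriv 2 (u t) + avgNL p (u t)))).re) t := by
  have e : ∀ a b : L2, (inner ℂ (((p + 1 : ℝ) : ℂ) • a) b).re = (p + 1) * (inner ℂ a b).re :=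
    fun a b => by
      rw [inner_smul_left, Complex.conj_ofReal, Complex.re_ofReal_mul]
  have h2 := (hu.mem t ht).isWeakDeriv (j := 2) (by norm_num)
  rw [← e]
  refine hasDerivAt_of_convex (n := fun s => ((p + 1 : ℝ) : ℂ) • avgNL p (u s)) (hu.hasDerivAt ht)
    ((hu.continuousAt_avgNL hp ht).const_smul ((p + 1 : ℝ) : ℂ)) ?_ ?_
  · filter_upwards [hu.eventually_mem ht] with s hs
    rw [e]
    exact avgPotential_convex hp h2 (hs.isWeakDeriv (by norm_num))
  · filter_upwards [hu.eventually_mem ht] with s hs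
    rw [e]
    exact avgPotential_convex hp (hs.isWeakDeriv (by norm_num)) h2

theorem IsSolution.hasDerivAt_energy (hp : 2 < p) (hu : IsSolution p Tmin Tmax u₀ u) {t : ℝ}
    (ht : t ∈ timeInterval Tmin Tmax) : HasDerivAt (fun s => energy p (u s)) 0 t := by
  have hq := hasDerivAt_quadratic (hu.hasDerivAt ht) (hu.continuousAt_weakDeriv_two ht) (by
    filter_upwards [hu.eventually_mem ht] with s hs
    exact hs.inner_weakDeriv_two_symm (hu.mem t ht))
  have h := (hq.const_mul (-(1 / 2))).sub
    ((hu.hasDerivAt_avgPotential hp ht).const_mul (1 / (p + 1)))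
  refine (h.congr_of_eventuallyEq ?_).congr_deriv ?_
  · filter_upwards [hu.eventually_mem ht] with s hs
    simp only [energy, hs.norm_sq_weakDeriv, avgPotential, Pi.sub_apply]
    ring
  -- Hamiltonian structure: the gradient of E is −(u_xx + N) and u_t is i times u_xx + N, so the two
  -- are orthogonal in the real inner product.
  · have hz : ∀ w : L2, (inner ℂ w (Complex.I • w)).re = 0 := fun w => by
      rw [inner_smul_right, inner_self_eq_norm_sq_to_K]
      simp [← Complex.ofReal_pow]
    have h3 := hz (weakDeriv 2 (u t) + avgNL p (u t))
    rw [inner_add_left, Complex.add_re] at h3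
    have hp1 : p + 1 ≠ 0 := by linarith
    field_simp
    linarith

theorem IsSolution.energy_eq (hp : 2 < p) (hTmin : 0 < Tmin) (hTmax : 0 < Tmax)
    (hu : IsSolution p Tmin Tmax u₀ u) {t : ℝ} (ht : t ∈ timeInterval Tmin Tmax) :
    energy p (u t) = energy p u₀ := by
  rw [← hu.initial]
  exact (isOpen_timeInterval Tmin Tmax).is_const_of_deriv_eq_zero
    (ordConnected_timeInterval Tmin Tmax).isPreconnected
    (fun s hs => (hu.hasDerivAt_energy hp hs).differentiableAt.differentiableWithinAt)
    (fun s hs => (hu.hasDerivAt_energy hp hs).deriv) ht (zero_mem_timeInterval hTmin hTmax)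

/-- The derivative is W + 2 Im⟨N, x²u⟩, and the second term is nonnegative. -/
theorem IsSolution.hasDerivAt_variance (hp : 5 ≤ p) (hu : IsSolution p Tmin Tmax u₀ u) {t : ℝ}
    (ht : t ∈ timeInterval Tmin Tmax) :
    ∃ d, HasDerivAt (fun s => variance (u s)) d t ∧ virial (u t) ≤ d := by
  have hm := hu.mem t ht
  have hq := hasDerivAt_quadratic (hu.hasDerivAt ht) (hu.continuousAt_weightMul_two ht) (by
    filter_upwards [hu.eventually_mem ht] with s hs
    exact IsMul.inner_left (a := fun x => x ^ 2) (hs.isMul (by norm_num)) (hm.isMul (by norm_num)))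
  refine ⟨_, hq.congr_of_eventuallyEq ?_, ?_⟩
  · filter_upwards [hu.eventually_mem ht] with s hs using hs.variance_eq
  · have h1 := im_inner_avgNL_sq_nonneg (by linarith) hp (hm.isWeakDeriv (j := 1) (by norm_num))
      (hm.isWeakDeriv (j := 2) (by norm_num)) hm.isMul_one hm.isMul_deriv hm.isMul_weightMul
    rw [← inner_conj_symm, Complex.conj_im] at h1
    rw [inner_smul_right, inner_add_right, Complex.I_mul_re, Complex.add_im,
      hm.im_inner_weightMul_sq, hm.virial_eq_im]
    linarith

theorem IsSolution.hasDerivAt_virial (hp : 2 < p) (hTmin : 0 < Tmin) (hTmax : 0 < Tmax)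
    (hu : IsSolution p Tmin Tmax u₀ u) {t : ℝ} (ht : t ∈ timeInterval Tmin Tmax) :
    ∃ d, HasDerivAt (fun s => virial (u s)) d t ∧ d ≤ Phi p u₀ (u t) := by
  have hm := hu.mem t ht
  have hq := hasDerivAt_quadratic (hu.hasDerivAt ht) (hu.continuousAt_dilationGen ht) (by
    filter_upwards [hu.eventually_mem ht] with s hs
    exact hs.inner_dilationGen_symm hm)
  refine ⟨_, hq.congr_of_eventuallyEq ?_, ?_⟩
  · filter_upwards [hu.eventually_mem ht] with s hs using hs.virial_eq
  · have h2 := hm.isWeakDeriv (j := 2) (by norm_num)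
    have hself := re_inner_avgNL_self hp h2
    have hdil := re_inner_avgNL_dilation hp (hm.isWeakDeriv (j := 1) (by norm_num)) h2
      hm.isMul_one hm.isMul_deriv
    have hre := hm.re_inner_weightMul_deriv
    have hns := hm.norm_sq_weakDeriv
    have hE := hu.energy_eq hp hTmin hTmax ht
    have hP := potential_nonneg p 1 (u t)
    rw [← inner_conj_symm, Complex.conj_re] at hself hdil hns
    rw [inner_dilationGen, inner_smul_right, inner_smul_right, inner_add_right, inner_add_right,
      Phi, ← hE, energy]
    have e : (∫ r in (0 : ℝ)..1, potential p r (u t)) = avgPotential p (u t) := rfl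
    rw [e]
    have hp1 : 0 < p + 1 := by linarith
    have e2 : ∀ a b : ℂ, (2 * Complex.I * (2 * (Complex.I * a) + Complex.I * b)).re =
        -(4 * a.re + 2 * b.re) := fun a b => by
      have : 2 * Complex.I * (2 * (Complex.I * a) + Complex.I * b) = -(4 * a + 2 * b) := by
        linear_combination (4 * a + 2 * b) * Complex.I_mul_I
      rw [this]
      simp
    rw [e2, Complex.add_re, Complex.add_re]
    have hdil' : (inner ℂ (weightMul 1 (weakDeriv 1 (u t))) (avgNL p (u t))).re =
        (2 * potential p 1 (u t) - 3 * avgPotential p (u t)) / (p + 1) := by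
      rw [eq_div_iff hp1.ne']
      linarith
    rw [hself, hdil']
    -- The derivative of W is 8‖u_x‖² − 4A − 8(2P(1) − 3A)/(p+1). Trading the kinetic term for the
    -- conserved energy leaves Φ − 16P(1)/(p+1).
    have key : 16 * (1 / 2 * ‖weakDeriv 1 (u t)‖ ^ 2 - 1 / (p + 1) * avgPotential p (u t)) -
        4 * (p - 9) / (p + 1) * avgPotential p (u t) =
        8 * ‖weakDeriv 1 (u t)‖ ^ 2 - 4 * avgPotential p (u t) -
          8 * ((2 * potential p 1 (u t) - 3 * avgPotential p (u t)) / (p + 1)) +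
          16 * (potential p 1 (u t) / (p + 1)) := by
      field_simp
      ring
    have hP' : 0 ≤ potential p 1 (u t) / (p + 1) := div_nonneg hP hp1.le
    rw [key]
    linarith

theorem IsSolution.continuousOn_Phi (hp : 2 < p) (hu : IsSolution p Tmin Tmax u₀ u) :
    ContinuousOn (fun s => Phi p u₀ (u s)) (timeInterval Tmin Tmax) := fun _ ht =>
  (continuousAt_const.sub (continuousAt_const.mul
    (hu.hasDerivAt_avgPotential hp ht).continuousAt)).continuousWithinAt

end Solution

/-! ### Integrating the differential inequalities. -/

theorem hasDerivAt_integral_of_continuousOn {J : Set ℝ} (hJ : IsOpen J) (hc : J.OrdConnected)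
    {φ : ℝ → ℝ} (hφ : ContinuousOn φ J) {a t : ℝ} (ha : a ∈ J) (ht : t ∈ J) :
    HasDerivAt (fun s => ∫ τ in a..s, φ τ) (φ t) t :=
  intervalIntegral.integral_hasDerivAt_right ((hφ.mono (hc.uIcc_subset ha ht)).intervalIntegrable)
    (hφ.stronglyMeasurableAtFilter hJ t ht) (hφ.continuousAt (hJ.mem_nhds ht))

/-- A double integration of a differential inequality towards the past. -/
theorem le_of_second_order_inequality {J : Set ℝ} (hJ : IsOpen J) (hc : J.OrdConnected)
    {V W φ : ℝ → ℝ} (hφ : ContinuousOn φ J) (h0 : (0 : ℝ) ∈ J)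
    (hV : ∀ t ∈ J, ∃ d, HasDerivAt V d t ∧ W t ≤ d)
    (hW : ∀ t ∈ J, ∃ d, HasDerivAt W d t ∧ d ≤ φ t) {t : ℝ} (ht : t ∈ J) (ht0 : t ≤ 0) :
    V t ≤ V 0 + W 0 * t + ∫ s in (0 : ℝ)..t, ∫ τ in (0 : ℝ)..s, φ τ := by
  have hd1 : ∀ s ∈ J, HasDerivAt (fun s => ∫ τ in (0 : ℝ)..s, φ τ) (φ s) s := fun s hs =>
    hasDerivAt_integral_of_continuousOn hJ hc hφ h0 hs
  have hd2 : ∀ s ∈ J, HasDerivAt (fun s => ∫ σ in (0 : ℝ)..s, ∫ τ in (0 : ℝ)..σ, φ τ)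
      (∫ τ in (0 : ℝ)..s, φ τ) s := fun s hs =>
    hasDerivAt_integral_of_continuousOn hJ hc
      (fun s hs => (hd1 s hs).continuousAt.continuousWithinAt) h0 hs
  have hsub : ∀ s ∈ J, Set.Icc s 0 ⊆ J := fun s hs => hc.out hs h0
  -- W − ∫₀φ is nonincreasing, so at earlier times it is at least its value at 0.
  have hW' : ∀ s ∈ J, s ≤ 0 → W 0 + ∫ τ in (0 : ℝ)..s, φ τ ≤ W s := fun s hs hs0 => by
    have hd : ∀ σ ∈ J, ∃ d, HasDerivAt (fun σ => W σ - ∫ τ in (0 : ℝ)..σ, φ τ) d σ ∧ d ≤ 0 :=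
      fun σ hσ => by
        obtain ⟨d, h1, h2⟩ := hW σ hσ
        exact ⟨_, h1.sub (hd1 σ hσ), by linarith⟩
    have hanti := antitoneOn_of_deriv_nonpos (convex_Icc s 0)
      (fun σ hσ => (hd σ (hsub s hs hσ)).choose_spec.1.continuousAt.continuousWithinAt)
      (fun σ hσ => (hd σ (hsub s hs (interior_subset hσ))).choose_spec.1.differentiableAt
        |>.differentiableWithinAt)
      (fun σ hσ => by
        obtain ⟨d, h1, h2⟩ := hd σ (hsub s hs (interior_subset hσ))
        rw [h1.deriv]
        exact h2)
    have := hanti (Set.left_mem_Icc.2 hs0) (Set.right_mem_Icc.2 hs0) hs0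
    simp only [intervalIntegral.integral_same] at this
    linarith
  -- On the past V' dominates W, which dominates the derivative of the comparison function, so the
  -- difference is nondecreasing up to 0. This sign holds only for σ ≤ 0.
  have hd : ∀ σ ∈ J, ∃ d, HasDerivAt (fun σ => V σ - (W 0 * σ +
      ∫ s in (0 : ℝ)..σ, ∫ τ in (0 : ℝ)..s, φ τ)) d σ ∧ (σ ≤ 0 → 0 ≤ d) := fun σ hσ => by
    obtain ⟨d, h1, h2⟩ := hV σ hσ
    refine ⟨_, h1.sub (((hasDerivAt_id' σ).const_mul (W 0)).add (hd2 σ hσ)), fun h => ?_⟩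
    have := hW' σ hσ h
    linarith
  have hmono := monotoneOn_of_deriv_nonneg (convex_Icc t 0)
    (fun σ hσ => (hd σ (hsub t ht hσ)).choose_spec.1.continuousAt.continuousWithinAt)
    (fun σ hσ => (hd σ (hsub t ht (interior_subset hσ))).choose_spec.1.differentiableAt
      |>.differentiableWithinAt)
    (fun σ hσ => by
      obtain ⟨d, h1, h2⟩ := hd σ (hsub t ht (interior_subset hσ))
      rw [h1.deriv]
      exact h2 (interior_subset hσ).2)
  have := hmono (Set.left_mem_Icc.2 ht0) (Set.right_mem_Icc.2 ht0) ht0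
  simp only [intervalIntegral.integral_same, mul_zero] at this
  linarith

end DMNLS

end

theorem proposition3p1 (p : ℝ) (hp : 9 ≤ p)
    (Tmin Tmax : EReal) (hTmin : 0 < Tmin) (hTmax : 0 < Tmax)
    (u₀ : DMNLS.L2) (u : ℝ → DMNLS.L2) (hu : DMNLS.IsSolution p Tmin Tmax u₀ u) :
    -- all the quantities in the inequality are well defined
    (∀ t ∈ DMNLS.timeInterval Tmin Tmax,
      Integrable (fun x : ℝ => x ^ 2 * ‖u t x‖ ^ 2) ∧
      Integrable (fun x : ℝ => (x : ℂ) * DMNLS.weakDeriv 1 (u t) x * conj (u t x)) ∧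
      (∀ r ∈ Set.Icc (0 : ℝ) 1,
        Integrable (fun x : ℝ => ‖DMNLS.propagator r (u t) x‖ ^ (p + 1))) ∧
      IntervalIntegrable (fun r : ℝ => DMNLS.potential p r (u t)) volume 0 1 ∧
      IntervalIntegrable (fun τ : ℝ => DMNLS.Phi p u₀ (u τ)) volume 0 t) ∧
    -- the variance estimate
    ∀ t : ℝ, -Tmin < (t : EReal) → t ≤ 0 →
      DMNLS.variance (u t) ≤ DMNLS.variance (u 0) + DMNLS.virial (u 0) * t +
        ∫ s in (0 : ℝ)..t, ∫ τ in (0 : ℝ)..s, DMNLS.Phi p u₀ (u τ) := by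
  have hp2 : 2 < p := by linarith
  have hJ := DMNLS.isOpen_timeInterval Tmin Tmax
  have hc := DMNLS.ordConnected_timeInterval Tmin Tmax
  have h0 := DMNLS.zero_mem_timeInterval hTmin hTmax
  have hφ := hu.continuousOn_Phi hp2
  refine ⟨fun t ht => ?_, fun t ht ht0 => ?_⟩
  · have hm := hu.mem t ht
    have h2 := hm.isWeakDeriv (j := 2) (by norm_num)
    exact ⟨hm.integrable_variance, hm.integrable_virial,
      fun r _ => DMNLS.integrable_norm_rpow (by linarith) (DMNLS.ae_norm_propagator_le h2 r),
      (DMNLS.continuous_potential hp2 h2).intervalIntegrable 0 1,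
      (hφ.mono (hc.uIcc_subset h0 ht)).intervalIntegrable⟩
  · have htJ : t ∈ DMNLS.timeInterval Tmin Tmax :=
      ⟨ht, (EReal.coe_le_coe_iff.2 ht0).trans_lt hTmax⟩
    exact DMNLS.le_of_second_order_inequality hJ hc (V := fun s => DMNLS.variance (u s))
      (W := fun s => DMNLS.virial (u s)) hφ h0
      (fun s hs => hu.hasDerivAt_variance (by linarith) hs)
      (fun s hs => hu.hasDerivAt_virial hp2 hTmin hTmax hs) htJ ht0
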